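/- Let $G$ be a discrete group, $H\lhd G$ a finite normal subgroup, $G_0=G/H$, and let $M$ be a locally compact Hausdorff space (for example a manifold) with a proper action of $G$ such that the stationary subgroup of every point is exactly $H$; thus $H$ acts trivially and $G_0$ acts freely on $M$. Let $F$ and $V$ be finite-dimensional complex inner product spaces, $\rho$ an irreducible complex linear representation of $H$ on $V$, and $u:G\to H$ a map with $u(gh)=u(g)h$ and $u(1)=1$ for $g\in G$, $h\in H$. Notation. (1) Objects of $\mathrm{Vect}_G(M,\rho)$ (with fibre $F\otimes V$) are $G$-equivariant complex vector bundles $\xi$ over $M$ which, as $H$-bundles, are isomorphic to $\xi_0\otimes V$, where $\xi_0$ is a vector bundle with fibre $F$ on which $H$ acts trivially and $V$ is the trivial bundle on which $H$ acts by $\rho$. An isomorphism $\xi\to\eta$ in $\mathrm{Vect}_G(M,\rho)$ is a $G$-equivariant homeomorphism of total spaces that maps fibres onto fibres by linear isomorphisms and covers a map $M\to M$ that induces the identity of $M/G_0$. (2) $G_0\times(F\otimes V)$ carries the canonical action $g_1\cdot([g],t)=([g_1g],(\mathrm{id}\otimes\rho(u(g_1g)u(g)^{-1}))\,t)$, and $L=\mathrm{Aut}_G(G_0\times(F\otimes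 V))$ is the group, with the compact-open topology, of its $G$-equivariant self-homeomorphisms that map fibres onto fibres by linear isomorphisms (covering some map $G_0\to G_0$). (3) An equivariant chart of $\xi$ is an open set $U\subset M$ whose translates $[g]U$, $[g]\in G_0$, are pairwise disjoint, together with a $G$-equivariant fibrewise linear homeomorphism $\psi:U\times(G_0\times(F\otimes V))\to\xi|_{O}$, $O=\bigsqcup_{[g]}[g]U$, that maps the fibre at $(y,[g])$ onto $\xi_{gy}$. An equivariant atlas is a family of charts $(U_\alpha,\psi_\alpha)$ whose sets $O_\alpha$ cover $M$. The sets $U_\alpha$ project homeomorphically onto open sets of $M/G_0$, and the transition functions $\Psi_{\alpha\beta}=\psi_\beta^{-1}\psi_\alpha$ are read as $L$-valued functions on the intersections of these open sets in $M/G_0$. (4) $\mathrm{Bundle}(M/G_0,L)$ is the category of principal $L$-bundles over $M/G_0$, with isomorphisms over the identity of $M/G_0$. Theorem. Every $\xi\in\mathrm{Vect}_G(M,\rho)$ has an equivariant atlas. There is an injective map $$\Phi:\ \mathrm{Vect}_G(M,\rho)/\!\cong\ \longrightarrow\ \mathrm{Bundle}(M/G_0,L)/\!\cong$$ such that, for every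 $\xi$, every equivariant atlas of $\xi$ with transition functions $\Psi_{\alpha\beta}$, and every principal $L$-bundle $P$ over $M/G_0$: $\Phi[\xi]=[P]$ if and only if $P$ has local trivializations over the images of the $U_\alpha$ in $M/G_0$ with transition functions $\Psi_{\alpha\beta}$. Moreover, if $P$ and $Q$ are principal $L$-bundles obtained in this way from atlases of $\xi$ and $\eta$, then the isomorphisms $\xi\to\eta$ and the isomorphisms $P\to Q$ correspond to each other bijectively, two corresponding isomorphisms being given in the charts by the same $L$-valued functions. -/

import Mathlib

open scoped TensorProduct Topology

universe w

/-- A complex vector bundle over `M` with (finite-dimensional) standard fibre `F`. -/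
structure CVectBundle (M : Type w) [TopologicalSpace M] (F : Type w) [NormedAddCommGroup F]
    [NormedSpace ℂ F] where
  E : M → Type w
  [addCommGroup : ∀ x, AddCommGroup (E x)]
  [module : ∀ x, Module ℂ (E x)]
  [fiberTopology : ∀ x, TopologicalSpace (E x)]
  [totalTopology : TopologicalSpace (Bundle.TotalSpace F E)]
  [fiberBundle : FiberBundle F E]
  [vectorBundle : VectorBundle ℂ F E]

attribute [instance] CVectBundle.addCommGroup CVectBundle.module CVectBundle.fiberTopology
  CVectBundle.totalTopology CVectBundle.fiberBundle CVectBundle.vectorBundle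

/-- The total space of a vector bundle. -/
abbrev CVectBundle.Tot {M : Type w} [TopologicalSpace M] {F : Type w} [NormedAddCommGroup F]
    [NormedSpace ℂ F] (ξ : CVectBundle M F) : Type w :=
  Bundle.TotalSpace F ξ.E

/-- The orbit space. If `H` acts trivially then this is `M / G₀` with `G₀ = G / H`. -/
abbrev OrbitSpace (G : Type w) [Group G] (M : Type w) [MulAction G M] : Type w :=
  Quotient (MulAction.orbitRel G M)

/-- The class of a point in the orbit space. -/
def orbitMk (G : Type w) [Group G] {M : Type w} [MulAction G M] (x : M) : OrbitSpace G M :=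
  Quotient.mk _ x

section CanonicalModel

variable {G : Type w} [Group G]

/-- A homomorphism of right `H`-modules `u : G → H` with `u(1) = 1`. -/
structure RightHMap (H : Subgroup G) where
  toFun : G → H
  map_mul : ∀ (g : G) (h : H), toFun (g * h) = toFun g * h
  map_one : toFun 1 = 1

/-- `u(g₁g)u(g)⁻¹`, which depends only on `g₁` and on the class `[g]`. -/
def RightHMap.cocycle {H : Subgroup G} (u : RightHMap H) (g₁ : G) (q : G ⧸ H) : H :=
  Quotient.liftOn' q (fun g => u.toFun (g₁ * g) * (u.toFun g)⁻¹) (by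
    intro a b hab
    rw [QuotientGroup.leftRel_apply] at hab
    have hb : b = a * ((⟨a⁻¹ * b, hab⟩ : H) : G) := by simp
    have h1 : u.toFun b = u.toFun a * ⟨a⁻¹ * b, hab⟩ := by
      conv_lhs => rw [hb]
      exact u.map_mul a _
    have h2 : u.toFun (g₁ * b) = u.toFun (g₁ * a) * ⟨a⁻¹ * b, hab⟩ := by
      conv_lhs => rw [hb, ← mul_assoc]
      exact u.map_mul (g₁ * a) _
    simp only [h1, h2]
    group)

/-- The total space `G₀ × (F ⊗ V)` of the canonical model, where `G₀ = G / H`. -/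
abbrev CanonicalModel (H : Subgroup G) (F V : Type w) [NormedAddCommGroup F]
    [InnerProductSpace ℂ F] [NormedAddCommGroup V] [InnerProductSpace ℂ V] : Type w :=
  (G ⧸ H) × (F ⊗[ℂ] V)

variable {H : Subgroup G} {F V : Type w} [NormedAddCommGroup F] [InnerProductSpace ℂ F]
  [NormedAddCommGroup V] [InnerProductSpace ℂ V]

/-- The canonical action of `G` on `G₀ × (F ⊗ V)`:
`g₁ · ([g], t) = ([g₁g], (id ⊗ ρ(u(g₁g)u(g)⁻¹)) t)`. -/
noncomputable def canonicalAct (ρ : Representation ℂ H V) (u : RightHMap H) (g₁ : G)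
    (p : CanonicalModel H F V) : CanonicalModel H F V :=
  (g₁ • p.1, LinearMap.lTensor F (ρ (u.cocycle g₁ p.1)) p.2)

variable [TopologicalSpace G]

/-- The group `Aut_G(G₀ × (F ⊗ V))`, under composition: the homeomorphisms of
`G₀ × (F ⊗ V)` that map fibres onto fibres by linear isomorphisms (covering some map of the
base `G₀`) and commute with the canonical action. -/
noncomputable def autSubgroup (F : Type w) [NormedAddCommGroup F] [InnerProductSpace ℂ F]
    (ρ : Representation ℂ H V) (u : RightHMap H) :
    Subgroup (CanonicalModel H F V ≃ₜ CanonicalModel H F V) where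
  carrier := {f | (∀ q : G ⧸ H, ∃ (q' : G ⧸ H) (A : (F ⊗[ℂ] V) ≃ₗ[ℂ] (F ⊗[ℂ] V)),
      ∀ t, f (q, t) = (q', A t)) ∧
    ∀ (g : G) (p : CanonicalModel H F V), f (canonicalAct ρ u g p) = canonicalAct ρ u g (f p)}
  mul_mem' := by
    rintro f f' ⟨hf, hf2⟩ ⟨hf', hf2'⟩
    refine ⟨fun q => ?_, fun g p => ?_⟩
    · obtain ⟨q', A, hA⟩ := hf' q
      obtain ⟨q'', B, hB⟩ := hf q'
      exact ⟨q'', A.trans B, fun t => by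
        change f (f' (q, t)) = _
        rw [hA, hB]; rfl⟩
    · change f (f' _) = canonicalAct ρ u g (f (f' p))
      rw [hf2', hf2]
  one_mem' := ⟨fun q => ⟨q, LinearEquiv.refl ℂ _, fun _ => rfl⟩, fun _ _ => rfl⟩
  inv_mem' := by
    rintro f ⟨hf, hf2⟩
    refine ⟨fun q => ?_, fun g p => ?_⟩
    · obtain ⟨q', A, hA⟩ := hf (f.symm (q, 0)).1
      have h0 : f ((f.symm (q, 0)).1, (f.symm (q, 0)).2) = (q, 0) := f.apply_symm_apply _
      rw [hA] at h0
      have hq : q' = q := congrArg Prod.fst h0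
      subst hq
      refine ⟨(f.symm (q', 0)).1, A.symm, fun t => ?_⟩
      change f.symm (q', t) = _
      rw [Homeomorph.symm_apply_eq, hA, LinearEquiv.apply_symm_apply]
    · change f.symm _ = canonicalAct ρ u g (f.symm p)
      rw [Homeomorph.symm_apply_eq, hf2, Homeomorph.apply_symm_apply]

/-- `Aut_G(G₀ × (F ⊗ V))` as a type. -/
abbrev AutG (F : Type w) [NormedAddCommGroup F] [InnerProductSpace ℂ F]
    (ρ : Representation ℂ H V) (u : RightHMap H) : Type w :=
  ↥(autSubgroup F ρ u)

/-- The compact-open topology on `Aut_G(G₀ × (F ⊗ V))`. -/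
noncomputable instance AutG.instTopologicalSpace (ρ : Representation ℂ H V) (u : RightHMap H) :
    TopologicalSpace (AutG F ρ u) :=
  TopologicalSpace.induced
    (fun a => (⟨a.1, a.1.continuous⟩ : C(CanonicalModel H F V, CanonicalModel H F V)))
    inferInstance

end CanonicalModel

section EquivariantBundles

/-- An object of `Vect_G(M, ρ)` with fibre `F ⊗ V`: a vector bundle over `M` with fibre `F ⊗ V`
and a fibrewise linear action `Φ(x, g) = act g x : E_x → E_{gx}` of the discrete group `G`, which
as an `H`-bundle is a tensor product `ξ₀ ⊗ V`, where `ξ₀` is a vector bundle with fibre `F` on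
which `H` acts trivially and `H` acts on the trivial bundle `V` by `ρ`. The isomorphism
`τ : ξ₀ ⊗ V → ξ` is given as a fibrewise linear isomorphism that is continuous in the sense
that `e ↦ τ (e ⊗ v)` is continuous for all `v`. -/
structure VectG {G : Type w} [Group G] {H : Subgroup G} (M : Type w) [TopologicalSpace M]
    [MulAction G M] (F : Type w) {V : Type w} [NormedAddCommGroup F] [InnerProductSpace ℂ F]
    [NormedAddCommGroup V] [InnerProductSpace ℂ V] (ρ : Representation ℂ H V) where
  bundle : CVectBundle M (F ⊗[ℂ] V)
  act : ∀ (g : G) (x : M), bundle.E x →ₗ[ℂ] bundle.E (g • x)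
  act_one : ∀ (x : M) (e : bundle.E x),
    (⟨(1 : G) • x, act 1 x e⟩ : bundle.Tot) = ⟨x, e⟩
  act_mul : ∀ (g₁ g₂ : G) (x : M) (e : bundle.E x),
    (⟨(g₁ * g₂) • x, act (g₁ * g₂) x e⟩ : bundle.Tot) =
      ⟨g₁ • g₂ • x, act g₁ (g₂ • x) (act g₂ x e)⟩
  continuous_act : ∀ g : G,
    Continuous (fun e : bundle.Tot => (⟨g • e.1, act g e.1 e.2⟩ : bundle.Tot))
  isTensor : ∃ (ξ₀ : CVectBundle M F) (τ : ∀ x, (ξ₀.E x ⊗[ℂ] V) ≃ₗ[ℂ] bundle.E x),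
    (∀ v : V, Continuous
      (fun e : ξ₀.Tot => (⟨e.1, τ e.1 (e.2 ⊗ₜ[ℂ] v)⟩ : bundle.Tot))) ∧
    ∀ (h : H) (x : M) (t : ξ₀.E x ⊗[ℂ] V),
      (⟨(h : G) • x, act h x (τ x t)⟩ : bundle.Tot) =
        ⟨x, τ x (LinearMap.lTensor (ξ₀.E x) (ρ h) t)⟩

variable {G : Type w} [Group G] {H : Subgroup G} {M : Type w} [TopologicalSpace M]
    [MulAction G M] {F : Type w} {V : Type w} [NormedAddCommGroup F] [InnerProductSpace ℂ F]
    [NormedAddCommGroup V] [InnerProductSpace ℂ V] {ρ : Representation ℂ H V}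

/-- The total space of an equivariant bundle. -/
abbrev VectG.Tot (ξ : VectG M F ρ) : Type w := ξ.bundle.Tot

/-- The action of `G` on the total space of an equivariant bundle. -/
def VectG.gact (ξ : VectG M F ρ) (g : G) (e : ξ.Tot) : ξ.Tot := ⟨g • e.1, ξ.act g e.1 e.2⟩

/-- An isomorphism of equivariant bundles over `M / G₀`: a `G`-equivariant homeomorphism of the
total spaces which maps fibres onto fibres by linear isomorphisms and covers a map `M → M` that
induces the identity of `M / G₀`. -/
structure VectG.Iso (ξ η : VectG M F ρ) where
  toHomeo : ξ.Tot ≃ₜ η.Tot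
  linear : ∀ x : M, ∃ y : M, orbitMk G y = orbitMk G x ∧
    ∃ L : ξ.bundle.E x ≃ₗ[ℂ] η.bundle.E y, ∀ e, toHomeo ⟨x, e⟩ = ⟨y, L e⟩
  equivariant : ∀ (g : G) (e : ξ.Tot), toHomeo (ξ.gact g e) = η.gact g (toHomeo e)

/-- Isomorphism in `Vect_G(M, ρ)` as an equivalence relation. -/
instance VectG.setoid : Setoid (VectG M F ρ) where
  r ξ η := Nonempty (VectG.Iso ξ η)
  iseqv :=
    { refl := fun ξ => ⟨⟨Homeomorph.refl _, fun x => ⟨x, rfl, LinearEquiv.refl ℂ _,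
        fun _ => rfl⟩, fun _ _ => rfl⟩⟩
      symm := by
        rintro ξ η ⟨f⟩
        refine ⟨⟨f.toHomeo.symm, fun y => ?_, fun g e => ?_⟩⟩
        · obtain ⟨⟨x, v⟩, hxv⟩ : ∃ e, f.toHomeo.symm ⟨y, 0⟩ = e := ⟨_, rfl⟩
          obtain ⟨y', hy, L, hL⟩ := f.linear x
          have h0 : f.toHomeo ⟨x, v⟩ = ⟨y, 0⟩ := by
            rw [← hxv, Homeomorph.apply_symm_apply]
          rw [hL] at h0
          obtain rfl : y' = y := congrArg Bundle.TotalSpace.proj h0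
          refine ⟨x, hy.symm, L.symm, fun e => ?_⟩
          rw [Homeomorph.symm_apply_eq, hL, LinearEquiv.apply_symm_apply]
        · rw [Homeomorph.symm_apply_eq, f.equivariant, Homeomorph.apply_symm_apply]
      trans := by
        rintro ξ η ζ ⟨f⟩ ⟨f'⟩
        refine ⟨⟨f.toHomeo.trans f'.toHomeo, fun x => ?_, fun g e => ?_⟩⟩
        · obtain ⟨y, hy, L, hL⟩ := f.linear x
          obtain ⟨z, hz, L', hL'⟩ := f'.linear y
          exact ⟨z, hz.trans hy, L.trans L', fun e => by
            rw [Homeomorph.trans_apply, hL, hL']; rfl⟩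
        · rw [Homeomorph.trans_apply, f.equivariant, f'.equivariant, Homeomorph.trans_apply] }

variable [TopologicalSpace G]

/-- An equivariant chart: an open set `U` of `M` whose translates under `G₀` are pairwise
disjoint, so that `O = ⨆ [g]U` is homeomorphic to `U × G₀`, and a `G`-equivariant trivialization
`ψ : U × (G₀ × (F ⊗ V)) → ξ|_O`, a homeomorphism which maps the fibre at `(y, [g])` by a linear
isomorphism onto the fibre at `gy` and carries `id × (canonical action)` to the action on `ξ`. -/
structure EquivariantChart (u : RightHMap H) (ξ : VectG M F ρ) where
  U : TopologicalSpace.Opens M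
  translates : ∀ y ∈ U, ∀ g : G, g • y ∈ U → g ∈ H
  ψ : (U × CanonicalModel H F V) ≃ₜ {e : ξ.Tot // ∃ y ∈ U, ∃ g : G, e.1 = g • y}
  linear : ∀ (y : U) (g : G), ∃ L : (F ⊗[ℂ] V) ≃ₗ[ℂ] ξ.bundle.E (g • (y : M)),
    ∀ t, (ψ (y, ((g : G ⧸ H), t)) : ξ.Tot) = ⟨g • (y : M), L t⟩
  equivariant : ∀ (g : G) (y : U) (p : CanonicalModel H F V),
    (ψ (y, canonicalAct ρ u g p) : ξ.Tot) = ξ.gact g (ψ (y, p))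

/-- An atlas of equivariant charts. -/
structure EquivariantAtlas (u : RightHMap H) (ξ : VectG M F ρ) where
  ι : Type w
  chart : ι → EquivariantChart u ξ
  cover : ∀ x : M, ∃ (i : ι) (g : G), g • x ∈ (chart i).U

/-- The open set of `M / G₀` onto which the domain `U_i` of a chart projects
homeomorphically. -/
def EquivariantAtlas.base {u : RightHMap H} {ξ : VectG M F ρ} (A : EquivariantAtlas u ξ)
    (i : A.ι) : Set (OrbitSpace G M) :=
  orbitMk G '' ((A.chart i).U : Set M)

end EquivariantBundles

section PrincipalBundles

/-- A principal `L`-bundle over `X`: a space `P` with a continuous right action of `L` and a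
projection to `X`, locally isomorphic to the product with `L`. -/
structure PrincipalBundle (L : Type w) [Group L] [TopologicalSpace L] (X : Type w)
    [TopologicalSpace X] where
  P : Type w
  [topology : TopologicalSpace P]
  [action : MulAction Lᵐᵒᵖ P]
  [continuousAction : ContinuousSMul Lᵐᵒᵖ P]
  proj : P → X
  continuous_proj : Continuous proj
  locallyTrivial : ∀ x : X, ∃ O : Set X, IsOpen O ∧ x ∈ O ∧
    ∃ e : (O × L) ≃ₜ {p : P // proj p ∈ O},
      (∀ (y : O) (l : L), proj (e (y, l)) = y) ∧
      ∀ (y : O) (l l' : L), (e (y, l * l') : P) = MulOpposite.op l' • (e (y, l) : P)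

attribute [instance] PrincipalBundle.topology PrincipalBundle.action
  PrincipalBundle.continuousAction

variable {L : Type w} [Group L] [TopologicalSpace L] {X : Type w} [TopologicalSpace X]

/-- An isomorphism of principal `L`-bundles over `X` (covering the identity of `X`). -/
structure PrincipalBundle.Iso (P Q : PrincipalBundle L X) where
  toHomeo : P.P ≃ₜ Q.P
  proj_eq : ∀ p, Q.proj (toHomeo p) = P.proj p
  equivariant : ∀ (l : L) (p : P.P),
    toHomeo (MulOpposite.op l • p) = MulOpposite.op l • toHomeo p

/-- Isomorphism of principal bundles as an equivalence relation. -/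
instance PrincipalBundle.setoid : Setoid (PrincipalBundle L X) where
  r P Q := Nonempty (PrincipalBundle.Iso P Q)
  iseqv :=
    { refl := fun P => ⟨⟨Homeomorph.refl _, fun _ => rfl, fun _ _ => rfl⟩⟩
      symm := by
        rintro P Q ⟨f⟩
        refine ⟨⟨f.toHomeo.symm, fun p => ?_, fun l p => ?_⟩⟩
        · rw [← f.proj_eq, Homeomorph.apply_symm_apply]
        · rw [Homeomorph.symm_apply_eq, f.equivariant, Homeomorph.apply_symm_apply]
      trans := by
        rintro P Q R ⟨f⟩ ⟨f'⟩
        refine ⟨⟨f.toHomeo.trans f'.toHomeo, fun p => ?_, fun l p => ?_⟩⟩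
        · rw [Homeomorph.trans_apply, f'.proj_eq, f.proj_eq]
        · rw [Homeomorph.trans_apply, f.equivariant, f'.equivariant, Homeomorph.trans_apply] }

end PrincipalBundles

section Transition

variable {G : Type w} [Group G] {H : Subgroup G} {M : Type w} [TopologicalSpace M]
    [MulAction G M] {F : Type w} {V : Type w} [NormedAddCommGroup F] [InnerProductSpace ℂ F]
    [NormedAddCommGroup V] [InnerProductSpace ℂ V] {ρ : Representation ℂ H V}
    [TopologicalSpace G] {u : RightHMap H}

/-- The equivariant transition functions `Ψ_ij = ψ_j⁻¹ ψ_i` of an atlas of `ξ`, read as functions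
with values in `Aut_G(G₀ × (F ⊗ V))` on the overlaps of the open sets `U_i` viewed in `M / G₀`,
together with local trivializations of the principal bundle `P` over these sets that have the
same transition functions. -/
structure TransitionCharts {ξ : VectG M F ρ} (A : EquivariantAtlas u ξ)
    (P : PrincipalBundle (AutG F ρ u) (OrbitSpace G M)) where
  Ψ : A.ι → A.ι → OrbitSpace G M → AutG F ρ u
  vector_transition : ∀ (i j : A.ι) (y : (A.chart i).U) (z : (A.chart j).U),
    orbitMk G (y : M) = orbitMk G (z : M) → ∀ p : CanonicalModel H F V,
      ((A.chart i).ψ (y, p) : ξ.Tot) = (A.chart j).ψ (z, (Ψ i j (orbitMk G (y : M))).1 p)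
  τ : ∀ i : A.ι, (A.base i × AutG F ρ u) ≃ₜ {p : P.P // P.proj p ∈ A.base i}
  proj_τ : ∀ (i : A.ι) (x : A.base i) (l : AutG F ρ u), P.proj (τ i (x, l)) = x
  equivariant : ∀ (i : A.ι) (x : A.base i) (l l' : AutG F ρ u),
    (τ i (x, l * l') : P.P) = MulOpposite.op l' • (τ i (x, l) : P.P)
  principal_transition : ∀ (i j : A.ι) (x : OrbitSpace G M) (hi : x ∈ A.base i)
    (hj : x ∈ A.base j) (l : AutG F ρ u),
      (τ i (⟨x, hi⟩, l) : P.P) = τ j (⟨x, hj⟩, Ψ i j x * l)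

/-- The isomorphisms `f : ξ → η` and `k : P → Q` correspond to each other: in the charts, at every
point of `M / G₀`, both are given by the same element `l' l⁻¹` of `Aut_G(G₀ × (F ⊗ V))`. -/
def Corresponds {ξ η : VectG M F ρ} {A : EquivariantAtlas u ξ} {B : EquivariantAtlas u η}
    {P Q : PrincipalBundle (AutG F ρ u) (OrbitSpace G M)}
    (S : TransitionCharts A P) (T : TransitionCharts B Q)
    (f : VectG.Iso ξ η) (k : PrincipalBundle.Iso P Q) : Prop :=
  ∀ (i : A.ι) (j : B.ι) (y : (A.chart i).U) (z : (B.chart j).U)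
    (_ : orbitMk G (y : M) = orbitMk G (z : M)) (l l' : AutG F ρ u),
      k.toHomeo (S.τ i (⟨orbitMk G (y : M), Set.mem_image_of_mem _ y.2⟩, l)) =
          (T.τ j (⟨orbitMk G (z : M), Set.mem_image_of_mem _ z.2⟩, l') : Q.P) ↔
        ∀ p : CanonicalModel H F V,
          f.toHomeo ((A.chart i).ψ (y, l.1 p)) = ((B.chart j).ψ (z, l'.1 p) : η.Tot)

end Transition

/-!
The proof replaces the gluing construction of the principal bundle of `ξ` by an intrinsic one. A
*frame* of `ξ` is a `G`-equivariant map `φ : G₀ × (F ⊗ V) → ξ` which maps fibres onto fibres by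
linear isomorphisms. All stabilizers being equal to `H`, a frame is injective and its image is the
part of `ξ` over one orbit, so two frames over the same orbit differ by precomposition with a unique
element of `L = Aut_G(G₀ × (F ⊗ V))` (`Frame.exists_smul_eq`, `Frame.smul_left_injective`). With the
compact-open topology, the space of frames is therefore a candidate for a principal `L`-bundle over
`M / G₀`. An equivariant chart `(U, ψ)` gives the local section `y ↦ ψ(y, ·)`, and the resulting
trivialization is a homeomorphism (`EquivariantChart.frameTriv`), because `G₀ × (F ⊗ V)` is locally
compact, so that continuity into the compact-open topology can be tested after uncurrying. In these
trivializations, the transition functions of the frame bundle are those of the atlas.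

Equivariant charts exist (`nonempty_equivariantAtlas`): properness of the action and equality of the
stabilizers with `H` give small open sets with disjoint translates, the tensor product structure of
`ξ` gives an `H`-equivariant trivialization over such a set, and
`([g], t) ↦ g · T(y, ρ(u(g))⁻¹ t)` extends it to the canonical model.

The map `Φ` sends `ξ` to its frame bundle. Principal bundles with the same transition functions are
isomorphic by an isomorphism that is the identity in the trivializations
(`PrincipalBundle.LocalTrivializations.exists_iso`), so the principal bundles obtained from an atlas
of `ξ` are exactly those isomorphic to the frame bundle. An isomorphism `f : ξ → η` acts on frames
by `φ ↦ f ∘ φ`, and every isomorphism `k` of frame bundles arises from exactly one `f`, namely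
`f (φ p) = (k φ) p` (`frameBundleMap_bijective`). This yields both the injectivity of `Φ` and, after
identifying `P` and `Q` with the frame bundles, the correspondence of isomorphisms
(`corresponds_iff`).
-/

/-! ### The canonical model -/

lemma orbitMk_smul {G M : Type w} [Group G] [MulAction G M] (g : G) (x : M) :
    orbitMk G (g • x) = orbitMk G x :=
  Quotient.sound ⟨g, rfl⟩

lemma orbitMk_eq_iff {G M : Type w} [Group G] [MulAction G M] {x y : M} :
    orbitMk G x = orbitMk G y ↔ ∃ g : G, g • y = x :=
  Quotient.eq

section Model

variable {G : Type w} [Group G] {H : Subgroup G} {F V : Type w} [NormedAddCommGroup F]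
  [InnerProductSpace ℂ F] [NormedAddCommGroup V] [InnerProductSpace ℂ V]

lemma RightHMap.cocycle_one (u : RightHMap H) (g : G) :
    u.cocycle g ((1 : G) : G ⧸ H) = u.toFun g := by
  change u.toFun (g * 1) * (u.toFun 1)⁻¹ = _
  rw [mul_one, u.map_one, inv_one, mul_one]

/-- The canonical model is generated under `G` by its fibre over the unit class. -/
lemma canonicalAct_unit_fibre (ρ : Representation ℂ H V) (u : RightHMap H) (g : G)
    (t : F ⊗[ℂ] V) :
    canonicalAct ρ u g (((1 : G) : G ⧸ H), LinearMap.lTensor F (ρ (u.toFun g)⁻¹) t) =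
      ((g : G ⧸ H), t) := by
  refine Prod.ext ?_ ?_
  · change ((g * 1 : G) : G ⧸ H) = g
    rw [mul_one]
  · change LinearMap.lTensor F (ρ (u.cocycle g ((1 : G) : G ⧸ H))) _ = t
    rw [u.cocycle_one, ← LinearMap.comp_apply, ← LinearMap.lTensor_comp,
      ← Module.End.mul_eq_comp, ← map_mul, mul_inv_cancel, map_one]
    simp [Module.End.one_eq_id]

variable [TopologicalSpace G] [DiscreteTopology G]

instance QuotientGroup.discreteTopology_of_discrete : DiscreteTopology (G ⧸ H) :=
  discreteTopology_iff_forall_isOpen.2 fun s =>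
    (isOpen_coinduced (f := ((↑) : G → G ⧸ H))).2 (isOpen_discrete (_ ⁻¹' s))

/-- The sheets of a product with a discrete first factor are open. -/
lemma nhds_discrete_prod {D Y : Type*} [TopologicalSpace D] [DiscreteTopology D]
    [TopologicalSpace Y] (q : D) (t : Y) : 𝓝 (q, t) = (𝓝 t).map (Prod.mk q) := by
  rw [nhds_prod_eq, nhds_discrete, Filter.pure_prod]

variable [FiniteDimensional ℂ F] [FiniteDimensional ℂ V]

instance CanonicalModel.locallyCompactSpace : LocallyCompactSpace (CanonicalModel H F V) :=
  have := FiniteDimensional.proper_rclike ℂ (F ⊗[ℂ] V)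
  inferInstance

/-- Continuity is automatic: the sheets are open and linear maps of `F ⊗ V` are continuous. -/
lemma continuous_of_fibrewise_linear
    {f : CanonicalModel H F V → CanonicalModel H F V}
    (hf : ∀ q : G ⧸ H, ∃ (q' : G ⧸ H) (A : (F ⊗[ℂ] V) ≃ₗ[ℂ] (F ⊗[ℂ] V)),
      ∀ t, f (q, t) = (q', A t)) : Continuous f := by
  refine continuous_iff_continuousAt.2 fun ⟨q, t⟩ => ?_
  obtain ⟨q', A, hA⟩ := hf q
  have hc : Continuous fun t => f (q, t) := by
    simp_rw [hA]
    exact continuous_const.prodMk (A : (F ⊗[ℂ] V) →ₗ[ℂ] F ⊗[ℂ] V).continuous_of_finiteDimensional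
  rw [ContinuousAt, nhds_discrete_prod, Filter.tendsto_map'_iff]
  exact hc.tendsto t

end Model

/-! ### Frames over an orbit -/

section Frames

variable {G : Type w} [Group G] {H : Subgroup G} {M : Type w} [TopologicalSpace M]
    [MulAction G M] {F : Type w} {V : Type w} [NormedAddCommGroup F] [InnerProductSpace ℂ F]
    [NormedAddCommGroup V] [InnerProductSpace ℂ V] {ρ : Representation ℂ H V}

/-- A map from the canonical model to the total space of `ξ` which is `G`-equivariant and maps
fibres onto fibres by linear isomorphisms. If the stabilizers of the points of `M` are `H`, it
identifies the model with the part of `ξ` over one orbit. -/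
def IsFrame (u : RightHMap H) (ξ : VectG M F ρ) (φ : CanonicalModel H F V → ξ.Tot) : Prop :=
  (∀ q : G ⧸ H, ∃ (x : M) (A : (F ⊗[ℂ] V) ≃ₗ[ℂ] ξ.bundle.E x), ∀ t, φ (q, t) = ⟨x, A t⟩) ∧
    ∀ (g : G) (p : CanonicalModel H F V), φ (canonicalAct ρ u g p) = ξ.gact g (φ p)

lemma VectG.gact_mul (ξ : VectG M F ρ) (g₁ g₂ : G) (e : ξ.Tot) :
    ξ.gact (g₁ * g₂) e = ξ.gact g₁ (ξ.gact g₂ e) :=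
  ξ.act_mul g₁ g₂ e.1 e.2

lemma VectG.gact_one (ξ : VectG M F ρ) (e : ξ.Tot) : ξ.gact 1 e = e :=
  ξ.act_one e.1 e.2

lemma VectG.gact_injective (ξ : VectG M F ρ) (g : G) : Function.Injective (ξ.gact g) := by
  intro a b h
  rw [← ξ.gact_one a, ← ξ.gact_one b, ← inv_mul_cancel g, ξ.gact_mul, ξ.gact_mul, h]

namespace IsFrame

variable {u : RightHMap H} {ξ : VectG M F ρ} {φ φ' : CanonicalModel H F V → ξ.Tot}

lemma fst_eq (hφ : IsFrame u ξ φ) (q : G ⧸ H) (t t' : F ⊗[ℂ] V) : (φ (q, t)).1 = (φ (q, t')).1 := by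
  obtain ⟨x, A, hA⟩ := hφ.1 q
  rw [hA, hA]

/-- A frame sends the sheet `[g]` over the `g`-translate of the point under the sheet `[1]`. -/
lemma fst_coe (hφ : IsFrame u ξ φ) (g : G) (t : F ⊗[ℂ] V) :
    (φ ((g : G ⧸ H), t)).1 = g • (φ (((1 : G) : G ⧸ H), 0)).1 := by
  rw [← canonicalAct_unit_fibre ρ u g t, hφ.2, hφ.fst_eq _ 0]
  rfl

lemma orbitMk_fst (hφ : IsFrame u ξ φ) (p : CanonicalModel H F V) :
    orbitMk G (φ p).1 = orbitMk G (φ (((1 : G) : G ⧸ H), 0)).1 := by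
  obtain ⟨q, t⟩ := p
  induction q using QuotientGroup.induction_on with
  | H g => rw [hφ.fst_coe, orbitMk_smul]

lemma exists_eq_of_orbitMk (hφ : IsFrame u ξ φ) {e : ξ.Tot}
    (he : orbitMk G e.1 = orbitMk G (φ (((1 : G) : G ⧸ H), 0)).1) : ∃ p, φ p = e := by
  obtain ⟨x, v⟩ := e
  obtain ⟨g, hg⟩ := orbitMk_eq_iff.1 he
  obtain ⟨y, A, hA⟩ := hφ.1 (g : G ⧸ H)
  have hy : y = x := by
    change _ = (⟨x, v⟩ : ξ.Tot).1
    rw [← hg, ← hφ.fst_coe g 0, hA]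
  subst hy
  exact ⟨((g : G ⧸ H), A.symm v), by rw [hA, LinearEquiv.apply_symm_apply]⟩

lemma injective (quasiFree : ∀ x : M, MulAction.stabilizer G x = H) (hφ : IsFrame u ξ φ) :
    Function.Injective φ := by
  rintro ⟨q, t⟩ ⟨q', t'⟩ h
  obtain rfl : q = q' := by
    induction q using QuotientGroup.induction_on with
    | H g =>
      induction q' using QuotientGroup.induction_on with
      | H g' =>
        have h1 := congrArg Bundle.TotalSpace.proj h
        change (φ _).1 = (φ _).1 at h1
        rw [hφ.fst_coe g, hφ.fst_coe g'] at h1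
        rw [QuotientGroup.eq, ← quasiFree (φ (((1 : G) : G ⧸ H), 0)).1,
          MulAction.mem_stabilizer_iff, mul_smul, ← h1, inv_smul_smul]
  obtain ⟨x, A, hA⟩ := hφ.1 q
  rw [hA, hA] at h
  have h2 : A t = A t' := by simpa using h
  rw [A.injective h2]

lemma comp_aut [TopologicalSpace G] (hφ : IsFrame u ξ φ) (l : AutG F ρ u) :
    IsFrame u ξ (φ ∘ l.1) := by
  refine ⟨fun q => ?_, fun g p => ?_⟩
  · obtain ⟨q', A, hA⟩ := l.2.1 q
    obtain ⟨x, B, hB⟩ := hφ.1 q'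
    exact ⟨x, A.trans B, fun t => by rw [Function.comp_apply, hA, hB]; rfl⟩
  · rw [Function.comp_apply, l.2.2, hφ.2]; rfl

/-- For two frames over one orbit, the equation `φ' ∘ l = φ` has a solution `l` which is equivariant
and linear on fibres. That `l` is a homeomorphism follows by exchanging the frames. -/
lemma exists_comparison (quasiFree : ∀ x : M, MulAction.stabilizer G x = H)
    (hφ : IsFrame u ξ φ) (hφ' : IsFrame u ξ φ')
    (h : orbitMk G (φ (((1 : G) : G ⧸ H), 0)).1 = orbitMk G (φ' (((1 : G) : G ⧸ H), 0)).1) :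
    ∃ l : CanonicalModel H F V → CanonicalModel H F V, (∀ p, φ' (l p) = φ p) ∧
      (∀ q : G ⧸ H, ∃ (q' : G ⧸ H) (A : (F ⊗[ℂ] V) ≃ₗ[ℂ] (F ⊗[ℂ] V)),
        ∀ t, l (q, t) = (q', A t)) ∧
      ∀ (g : G) (p : CanonicalModel H F V),
        l (canonicalAct ρ u g p) = canonicalAct ρ u g (l p) := by
  choose l hl using fun p => hφ'.exists_eq_of_orbitMk ((hφ.orbitMk_fst p).trans h)
  have inj := hφ'.injective quasiFree
  refine ⟨l, hl, fun q => ?_, fun g p => inj ?_⟩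
  · obtain ⟨x, A, hA⟩ := hφ.1 q
    obtain ⟨x', A', hA'⟩ := hφ'.1 (l (q, 0)).1
    obtain rfl : x' = x := by
      have h0 := hl (q, 0)
      rw [← Prod.mk.eta (p := l (q, 0)), hA', hA] at h0
      exact congrArg Bundle.TotalSpace.proj h0
    exact ⟨_, A.trans A'.symm, fun t => inj (by
      rw [hl, hA, hA', LinearEquiv.trans_apply, LinearEquiv.apply_symm_apply])⟩
  · rw [hl, hφ.2, hφ'.2, hl]

/-- `Aut_G(G₀ × (F ⊗ V))` acts transitively on the frames over one orbit. -/
lemma exists_aut [TopologicalSpace G] [DiscreteTopology G] [FiniteDimensional ℂ F]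
    [FiniteDimensional ℂ V]
    (quasiFree : ∀ x : M, MulAction.stabilizer G x = H)
    (hφ : IsFrame u ξ φ) (hφ' : IsFrame u ξ φ')
    (h : orbitMk G (φ (((1 : G) : G ⧸ H), 0)).1 = orbitMk G (φ' (((1 : G) : G ⧸ H), 0)).1) :
    ∃ l : AutG F ρ u, ∀ p, φ' (l.1 p) = φ p := by
  obtain ⟨l, hl, hl1, hl2⟩ := hφ.exists_comparison quasiFree hφ' h
  obtain ⟨m, hm, hm1, -⟩ := hφ'.exists_comparison quasiFree hφ h.symm
  exact ⟨⟨{ toFun := l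
            invFun := m
            left_inv := fun p => hφ.injective quasiFree (by rw [hm, hl])
            right_inv := fun p => hφ'.injective quasiFree (by rw [hl, hm])
            continuous_toFun := continuous_of_fibrewise_linear hl1
            continuous_invFun := continuous_of_fibrewise_linear hm1 }, hl1, hl2⟩, hl⟩

end IsFrame

lemma AutG.ext [TopologicalSpace G] {u : RightHMap H} {l l' : AutG F ρ u}
    (h : ∀ p, l.1 p = l'.1 p) : l = l' :=
  Subtype.ext (Homeomorph.ext h)

end Frames

/-! ### The space of frames and its local trivializations -/

section FrameSpace

variable {G : Type w} [Group G] {H : Subgroup G} {M : Type w} [TopologicalSpace M]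
    [MulAction G M] {F : Type w} {V : Type w} [NormedAddCommGroup F] [InnerProductSpace ℂ F]
    [NormedAddCommGroup V] [InnerProductSpace ℂ V] {ρ : Representation ℂ H V}
    [TopologicalSpace G]

/-- The space of frames of `ξ`, with the compact-open topology. -/
def Frame (u : RightHMap H) (ξ : VectG M F ρ) : Type w :=
  {φ : C(CanonicalModel H F V, ξ.Tot) // IsFrame u ξ φ}

noncomputable instance (u : RightHMap H) (ξ : VectG M F ρ) : TopologicalSpace (Frame u ξ) :=
  inferInstanceAs (TopologicalSpace {φ : C(CanonicalModel H F V, ξ.Tot) // IsFrame u ξ φ})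

/-- The underlying continuous map of an automorphism of the canonical model. -/
noncomputable def AutG.toContinuousMap {u : RightHMap H} (l : AutG F ρ u) :
    C(CanonicalModel H F V, CanonicalModel H F V) :=
  ⟨l.1, l.1.continuous⟩

lemma AutG.continuous_toContinuousMap {u : RightHMap H} :
    Continuous (AutG.toContinuousMap : AutG F ρ u → _) :=
  continuous_induced_dom

variable {u : RightHMap H} {ξ η : VectG M F ρ}

/-- The right action on frames by precomposition, written as a left action of the opposite group. -/
noncomputable instance : MulAction (AutG F ρ u)ᵐᵒᵖ (Frame u ξ) where
  smul l φ := ⟨φ.1.comp l.unop.toContinuousMap, φ.2.comp_aut l.unop⟩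
  one_smul _ := rfl
  mul_smul _ _ _ := rfl

namespace Frame

@[ext] lemma ext {φ φ' : Frame u ξ} (h : ∀ p, φ.1 p = φ'.1 p) : φ = φ' :=
  Subtype.ext (ContinuousMap.ext h)

@[simp] lemma smul_apply (l : AutG F ρ u) (φ : Frame u ξ) (p : CanonicalModel H F V) :
    (MulOpposite.op l • φ).1 p = φ.1 (l.1 p) := rfl

lemma continuous_val :
    Continuous fun φ : Frame u ξ => (φ.1 : C(CanonicalModel H F V, ξ.Tot)) :=
  continuous_subtype_val

/-- The orbit over which a frame lies. -/
noncomputable def proj (φ : Frame u ξ) : OrbitSpace G M :=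
  orbitMk G (φ.1 (((1 : G) : G ⧸ H), 0)).1

lemma orbitMk_apply (φ : Frame u ξ) (p : CanonicalModel H F V) :
    orbitMk G (φ.1 p).1 = φ.proj :=
  φ.2.orbitMk_fst p

@[simp] lemma proj_smul (l : AutG F ρ u) (φ : Frame u ξ) :
    (MulOpposite.op l • φ).proj = φ.proj :=
  φ.orbitMk_apply _

lemma continuous_proj : Continuous (proj : Frame u ξ → OrbitSpace G M) :=
  continuous_quotient_mk'.comp <| (FiberBundle.continuous_proj (F ⊗[ℂ] V) ξ.bundle.E).comp <|
    (continuous_eval_const _).comp continuous_val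

lemma exists_apply_eq (φ : Frame u ξ) {e : ξ.Tot} (he : orbitMk G e.1 = φ.proj) :
    ∃ p, φ.1 p = e :=
  φ.2.exists_eq_of_orbitMk he

variable [DiscreteTopology G] [FiniteDimensional ℂ F] [FiniteDimensional ℂ V]

instance : ContinuousSMul (AutG F ρ u)ᵐᵒᵖ (Frame u ξ) where
  continuous_smul := Continuous.subtype_mk
    ((continuous_val.comp continuous_snd).compCM
      (AutG.continuous_toContinuousMap.comp (MulOpposite.continuous_unop.comp continuous_fst))) _

lemma exists_smul_eq (quasiFree : ∀ x : M, MulAction.stabilizer G x = H) {φ φ' : Frame u ξ}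
    (h : φ.proj = φ'.proj) : ∃ l : AutG F ρ u, MulOpposite.op l • φ' = φ :=
  (φ.2.exists_aut quasiFree φ'.2 h).imp fun _ hl => Frame.ext hl

omit [DiscreteTopology G] [FiniteDimensional ℂ F] [FiniteDimensional ℂ V] in
lemma smul_left_injective (quasiFree : ∀ x : M, MulAction.stabilizer G x = H) (φ : Frame u ξ)
    {l l' : AutG F ρ u} (h : MulOpposite.op l • φ = MulOpposite.op l' • φ) : l = l' :=
  AutG.ext fun p => φ.2.injective quasiFree (by rw [← smul_apply, h, smul_apply])

end Frame

namespace EquivariantChart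

variable (c : EquivariantChart u ξ)

/-- A chart restricts to a frame over each point of its domain. -/
noncomputable def frame (y : c.U) : Frame u ξ where
  val := ⟨fun p => c.ψ (y, p), by fun_prop⟩
  property := by
    refine ⟨fun q => ?_, fun g p => c.equivariant g y p⟩
    induction q using QuotientGroup.induction_on with
    | H g =>
      obtain ⟨L, hL⟩ := c.linear y g
      exact ⟨_, L, hL⟩

lemma frame_apply (y : c.U) (p : CanonicalModel H F V) : (c.frame y).1 p = c.ψ (y, p) := rfl

lemma proj_frame (y : c.U) : (c.frame y).proj = orbitMk G (y : M) := by
  obtain ⟨L, hL⟩ := c.linear y 1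
  change orbitMk G (c.ψ _ : ξ.Tot).1 = _
  rw [hL]
  exact orbitMk_smul 1 _

lemma continuous_frame : Continuous c.frame :=
  Continuous.subtype_mk (ContinuousMap.continuous_of_continuous_uncurry _ (by
    exact continuous_subtype_val.comp c.ψ.continuous)) _

/-- The set of orbits which meet the domain of the chart; for the charts of an atlas this is
`EquivariantAtlas.base`. -/
def base : Set (OrbitSpace G M) := orbitMk G '' (c.U : Set M)

lemma isOpen_base [ContinuousConstSMul G M] : IsOpen c.base :=
  isOpenMap_quotient_mk'_mul _ c.U.2

variable (quasiFree : ∀ x : M, MulAction.stabilizer G x = H)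

include quasiFree in
lemma orbitMk_injOn {y z : M} (hy : y ∈ c.U) (hz : z ∈ c.U) (h : orbitMk G y = orbitMk G z) :
    y = z := by
  obtain ⟨g, rfl⟩ := orbitMk_eq_iff.1 h
  have hg := c.translates z hz g hy
  rwa [← quasiFree z] at hg

/-- The domain of a chart projects homeomorphically onto its set of orbits. -/
noncomputable def homeoBase [ContinuousConstSMul G M] : c.U ≃ₜ c.base :=
  (Equiv.ofBijective (fun y : c.U => (⟨orbitMk G (y : M), y, y.2, rfl⟩ : c.base))
    ⟨fun y z h => Subtype.ext (c.orbitMk_injOn quasiFree y.2 z.2 (congrArg Subtype.val h)),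
      by rintro ⟨_, y, hy, rfl⟩; exact ⟨⟨y, hy⟩, rfl⟩⟩).toHomeomorphOfContinuousOpen
    ((continuous_quotient_mk'.comp continuous_subtype_val).subtype_mk _)
    (by
      -- the projection to the orbit space of a group action is open
      have h : IsOpenMap fun y : c.U => orbitMk G (y : M) :=
        isOpenMap_quotient_mk'_mul.comp c.U.2.isOpenMap_subtype_val
      exact h.subtype_mk _)

lemma homeoBase_symm [ContinuousConstSMul G M] (y : c.U) (h : orbitMk G (y : M) ∈ c.base) :
    (c.homeoBase quasiFree).symm ⟨orbitMk G (y : M), h⟩ = y :=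
  (c.homeoBase quasiFree).symm_apply_apply y

lemma orbitMk_homeoBase_symm [ContinuousConstSMul G M] (x : c.base) :
    orbitMk G ((c.homeoBase quasiFree).symm x : M) = x :=
  congrArg Subtype.val ((c.homeoBase quasiFree).apply_symm_apply x)

variable [DiscreteTopology G] [FiniteDimensional ℂ F] [FiniteDimensional ℂ V]

/-- Over the orbits of a chart, every frame is a unique translate of the frame of the chart. -/
noncomputable def frameEquiv [ContinuousConstSMul G M] :
    (c.base × AutG F ρ u) ≃ {φ : Frame u ξ // φ.proj ∈ c.base} :=
  Equiv.ofBijective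
    (fun xl => ⟨MulOpposite.op xl.2 • c.frame ((c.homeoBase quasiFree).symm xl.1), by
      rw [Frame.proj_smul, proj_frame, orbitMk_homeoBase_symm]; exact xl.1.2⟩) (by
    constructor
    · rintro ⟨x, l⟩ ⟨x', l'⟩ h
      have h1 : MulOpposite.op l • c.frame ((c.homeoBase quasiFree).symm x) =
        MulOpposite.op l' • c.frame ((c.homeoBase quasiFree).symm x') := congrArg Subtype.val h
      obtain rfl : x = x' := by
        have h2 := congrArg Frame.proj h1
        simp only [Frame.proj_smul, proj_frame, orbitMk_homeoBase_symm] at h2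
        exact Subtype.ext h2
      rw [Frame.smul_left_injective quasiFree _ h1]
    · rintro ⟨φ, hφ⟩
      obtain ⟨l, hl⟩ := Frame.exists_smul_eq quasiFree (φ := φ)
        (φ' := c.frame ((c.homeoBase quasiFree).symm ⟨_, hφ⟩))
        (by rw [proj_frame, orbitMk_homeoBase_symm])
      exact ⟨(⟨_, hφ⟩, l), Subtype.ext hl⟩)

lemma frameEquiv_symm_smul [ContinuousConstSMul G M] (φ : {φ : Frame u ξ // φ.proj ∈ c.base}) :
    MulOpposite.op ((c.frameEquiv quasiFree).symm φ).2 •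
      c.frame ((c.homeoBase quasiFree).symm ((c.frameEquiv quasiFree).symm φ).1) = φ.1 :=
  congrArg Subtype.val ((c.frameEquiv quasiFree).apply_symm_apply φ)

/-- The coordinates of a frame in a chart depend continuously on the frame: the component in
`Aut_G(G₀ × (F ⊗ V))` is read off from `ψ⁻¹ ∘ φ`. -/
lemma continuous_frameEquiv_symm [ContinuousConstSMul G M] :
    Continuous (c.frameEquiv quasiFree).symm := by
  refine Continuous.prodMk (continuous_induced_rng.2 ?_) (continuous_induced_rng.2 ?_)
  · refine (Frame.continuous_proj.comp continuous_subtype_val).congr fun φ => ?_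
    change φ.1.proj = _
    rw [← c.frameEquiv_symm_smul quasiFree φ, Frame.proj_smul, proj_frame,
      orbitMk_homeoBase_symm]
    rfl
  · refine ContinuousMap.continuous_of_continuous_uncurry _ ?_
    have hmem : ∀ (φ : {φ : Frame u ξ // φ.proj ∈ c.base}) (p : CanonicalModel H F V),
        ∃ y ∈ c.U, ∃ g : G, (φ.1.1 p).1 = g • y := by
      rintro ⟨φ, y, hy, hyφ⟩ p
      obtain ⟨g, hg⟩ := orbitMk_eq_iff.1 ((φ.orbitMk_apply p).trans hyφ.symm)
      exact ⟨y, hy, g, hg.symm⟩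
    have hc : Continuous fun x : {φ : Frame u ξ // φ.proj ∈ c.base} × CanonicalModel H F V =>
        (c.ψ.symm ⟨x.1.1.1 x.2, hmem x.1 x.2⟩).2 := by
      refine continuous_snd.comp (c.ψ.symm.continuous.comp (Continuous.subtype_mk ?_ _))
      exact (Frame.continuous_val.comp (continuous_subtype_val.comp continuous_fst)).eval
        continuous_snd
    refine hc.congr fun ⟨φ, p⟩ => ?_
    have h2 : (⟨φ.1.1 p, hmem φ p⟩ : {e : ξ.Tot // ∃ y ∈ c.U, ∃ g : G, e.1 = g • y}) =
        c.ψ ((c.homeoBase quasiFree).symm ((c.frameEquiv quasiFree).symm φ).1,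
          ((c.frameEquiv quasiFree).symm φ).2.1 p) :=
      Subtype.ext (by
        rw [← frame_apply, ← Frame.smul_apply, c.frameEquiv_symm_smul quasiFree φ])
    change (c.ψ.symm ⟨φ.1.1 p, hmem φ p⟩).2 = _
    rw [h2, Homeomorph.symm_apply_apply]
    rfl

/-- Over the orbits of a chart, the frame space is trivialized by the frames of the chart. -/
noncomputable def frameTriv [ContinuousConstSMul G M] :
    (c.base × AutG F ρ u) ≃ₜ {φ : Frame u ξ // φ.proj ∈ c.base} where
  toEquiv := c.frameEquiv quasiFree
  continuous_toFun := Continuous.subtype_mk (Continuous.smul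
    (MulOpposite.continuous_op.comp continuous_snd)
    (c.continuous_frame.comp ((c.homeoBase quasiFree).symm.continuous.comp continuous_fst))) _
  continuous_invFun := c.continuous_frameEquiv_symm quasiFree

lemma coe_frameTriv [ContinuousConstSMul G M] (x : c.base) (l : AutG F ρ u) :
    (c.frameTriv quasiFree (x, l) : Frame u ξ) =
      MulOpposite.op l • c.frame ((c.homeoBase quasiFree).symm x) := rfl

end EquivariantChart

end FrameSpace

/-! ### Principal bundles with equal transition functions -/

section Gluing

variable {L : Type w} [Group L] [TopologicalSpace L] {X : Type w} [TopologicalSpace X]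

/-- The inverse isomorphism. -/
def PrincipalBundle.Iso.symm {P Q : PrincipalBundle L X} (k : PrincipalBundle.Iso P Q) :
    PrincipalBundle.Iso Q P where
  toHomeo := k.toHomeo.symm
  proj_eq p := by rw [← k.proj_eq, Homeomorph.apply_symm_apply]
  equivariant l p := by
    rw [Homeomorph.symm_apply_eq, k.equivariant, Homeomorph.apply_symm_apply]

/-- The composite isomorphism. -/
def PrincipalBundle.Iso.trans {P Q R : PrincipalBundle L X} (k : PrincipalBundle.Iso P Q)
    (k' : PrincipalBundle.Iso Q R) : PrincipalBundle.Iso P R where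
  toHomeo := k.toHomeo.trans k'.toHomeo
  proj_eq p := by rw [Homeomorph.trans_apply, k'.proj_eq, k.proj_eq]
  equivariant l p := by
    rw [Homeomorph.trans_apply, k.equivariant, k'.equivariant, Homeomorph.trans_apply]

lemma PrincipalBundle.Iso.ext {P Q : PrincipalBundle L X} {k k' : PrincipalBundle.Iso P Q}
    (h : ∀ p, k.toHomeo p = k'.toHomeo p) : k = k' := by
  cases k; cases k'
  congr
  exact Homeomorph.ext h

/-- Local trivializations of a principal bundle over the sets `B i`, with transition functions
`Ψ`. -/
structure PrincipalBundle.LocalTrivializations (P : PrincipalBundle L X) {ι : Type w}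
    (B : ι → Set X) (Ψ : ι → ι → X → L) where
  triv : ∀ i, (B i × L) ≃ₜ {p : P.P // P.proj p ∈ B i}
  proj_triv : ∀ (i : ι) (x : B i) (l : L), P.proj (triv i (x, l)) = x
  equivariant : ∀ (i : ι) (x : B i) (l l' : L),
    (triv i (x, l * l') : P.P) = MulOpposite.op l' • (triv i (x, l) : P.P)
  transition : ∀ (i j : ι) (x : X) (hi : x ∈ B i) (hj : x ∈ B j) (l : L),
    (triv i (⟨x, hi⟩, l) : P.P) = triv j (⟨x, hj⟩, Ψ i j x * l)

namespace PrincipalBundle.LocalTrivializations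

variable {P Q : PrincipalBundle L X} {ι : Type w} {B : ι → Set X} {Ψ : ι → ι → X → L}

lemma exists_triv_eq (S : P.LocalTrivializations B Ψ) {p : P.P} {i : ι} (hp : P.proj p ∈ B i) :
    ∃ l, (S.triv i (⟨P.proj p, hp⟩, l) : P.P) = p := by
  obtain ⟨⟨x, l⟩, hx⟩ := (S.triv i).surjective ⟨p, hp⟩
  have h1 : (S.triv i (x, l) : P.P) = p := congrArg Subtype.val hx
  obtain rfl : x = ⟨P.proj p, hp⟩ := Subtype.ext (by rw [← S.proj_triv i x l, h1])
  exact ⟨l, h1⟩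

/-- Gluing the local maps which are the identity in the trivializations; they agree on overlaps
because the transition functions are equal. -/
lemma exists_glue (S : P.LocalTrivializations B Ψ) (T : Q.LocalTrivializations B Ψ)
    (hB : ∀ i, IsOpen (B i)) (cover : ∀ x, ∃ i, x ∈ B i) :
    ∃ k : P.P → Q.P, Continuous k ∧
      ∀ (i : ι) (x : B i) (l : L), k (S.triv i (x, l)) = T.triv i (x, l) := by
  choose i hi using cover
  choose l hl using fun p : P.P => S.exists_triv_eq (hi (P.proj p))
  have key : ∀ (j : ι) (x : B j) (m : L),
      (T.triv (i (P.proj (S.triv j (x, m)))) (⟨_, hi _⟩, l (S.triv j (x, m))) : Q.P) =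
        T.triv j (x, m) := by
    intro j x m
    obtain ⟨p, hp⟩ : ∃ p, (S.triv j (x, m) : P.P) = p := ⟨_, rfl⟩
    have hx : (x : X) = P.proj p := by rw [← hp, S.proj_triv]
    obtain ⟨x, hxj⟩ := x
    subst hx
    -- express both points in the trivialization chosen at the base point of `p`
    rw [hp, T.transition j (i (P.proj p)) _ hxj (hi _)]
    have h1 := S.transition j (i (P.proj p)) _ hxj (hi _) m
    rw [hp] at h1
    have h2 := (S.triv (i (P.proj p))).injective (Subtype.ext ((hl p).trans h1))
    rw [h2]
  refine ⟨fun p => T.triv (i (P.proj p)) (⟨_, hi _⟩, l p), ?_, fun j x m => key j x m⟩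
  refine continuous_iff_continuousAt.2 fun p => ?_
  set j := i (P.proj p)
  have ho : IsOpen {p' : P.P | P.proj p' ∈ B j} := (hB j).preimage P.continuous_proj
  refine ContinuousOn.continuousAt (s := {p' : P.P | P.proj p' ∈ B j}) ?_ (ho.mem_nhds (hi _))
  rw [continuousOn_iff_continuous_domRestrict]
  have hc : Continuous fun p' : {p' : P.P // P.proj p' ∈ B j} =>
      (T.triv j ((S.triv j).symm p') : Q.P) := by fun_prop
  refine hc.congr fun p' => ?_
  obtain ⟨⟨x, m⟩, rfl⟩ := (S.triv j).surjective p'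
  rw [Homeomorph.symm_apply_apply]
  exact (key j x m).symm

/-- Principal bundles with the same transition functions over the same open cover are
isomorphic, by an isomorphism which is the identity in the trivializations. -/
lemma exists_iso (S : P.LocalTrivializations B Ψ) (T : Q.LocalTrivializations B Ψ)
    (hB : ∀ i, IsOpen (B i)) (cover : ∀ x, ∃ i, x ∈ B i) :
    ∃ k : PrincipalBundle.Iso P Q,
      ∀ (i : ι) (x : B i) (l : L), k.toHomeo (S.triv i (x, l)) = T.triv i (x, l) := by
  obtain ⟨k, hkc, hk⟩ := S.exists_glue T hB cover
  obtain ⟨m, hmc, hm⟩ := T.exists_glue S hB cover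
  have form : ∀ {R : PrincipalBundle L X} (U : R.LocalTrivializations B Ψ) (p : R.P),
      ∃ i x l, p = U.triv i (x, l) := fun U p => by
    obtain ⟨i, hi⟩ := cover (PrincipalBundle.proj _ p)
    obtain ⟨l, hl⟩ := U.exists_triv_eq hi
    exact ⟨i, _, l, hl.symm⟩
  refine ⟨⟨⟨⟨k, m, fun p => ?_, fun p => ?_⟩, hkc, hmc⟩, fun p => ?_, fun l p => ?_⟩, hk⟩
  · obtain ⟨i, x, l, rfl⟩ := form S p
    rw [hk, hm]
  · obtain ⟨i, x, l, rfl⟩ := form T p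
    rw [hm, hk]
  · obtain ⟨i, x, l, rfl⟩ := form S p
    change Q.proj (k _) = _
    rw [hk, S.proj_triv, T.proj_triv]
  · obtain ⟨i, x, l', rfl⟩ := form S p
    change k _ = _ • k _
    rw [← S.equivariant, hk, hk, T.equivariant]

end PrincipalBundle.LocalTrivializations

end Gluing

/-! ### Existence of equivariant charts -/

section LocalStructure

/-- Points with stabilizer `H` under a proper action of a discrete group have small
neighbourhoods whose only self-overlapping translates are those by `H`. -/
lemma exists_isOpen_translates {G : Type*} [Group G] [TopologicalSpace G] [DiscreteTopology G]
    {H : Subgroup G} {M : Type*} [TopologicalSpace M] [T2Space M] [LocallyCompactSpace M]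
    [MulAction G M] [ProperSMul G M] {x : M} (hx : MulAction.stabilizer G x = H) :
    ∃ U : Set M, IsOpen U ∧ x ∈ U ∧ ∀ y ∈ U, ∀ g : G, g • y ∈ U → g ∈ H := by
  have : ProperlyDiscontinuousSMul G M :=
    ⟨fun hK hL => (ProperSMul.isCompact_setOfPred_inter_nonempty hK hL).finite_of_discrete⟩
  obtain ⟨N, hN, hN'⟩ := ProperlyDiscontinuousSMul.exists_nhds_image_smul_eq_self G x
  obtain ⟨U, hUN, hU, hxU⟩ := mem_nhds_iff.1 hN
  refine ⟨U, hU, hxU, fun y hy g hg => ?_⟩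
  rw [← hx, MulAction.mem_stabilizer_iff]
  exact hN' g ⟨_, ⟨y, hUN hy, rfl⟩, hUN hg⟩

/-- A pointwise continuous family of linear automorphisms of a finite-dimensional space is a
homeomorphism of the trivial bundle. -/
noncomputable def homeomorphOfLinearFamily {Y W : Type*} [TopologicalSpace Y]
    [NormedAddCommGroup W] [NormedSpace ℂ W] [FiniteDimensional ℂ W] (A : Y → W ≃ₗ[ℂ] W)
    (hA : ∀ w, Continuous fun y => A y w) : (Y × W) ≃ₜ (Y × W) where
  toFun p := (p.1, A p.1 p.2)
  invFun p := (p.1, (A p.1).symm p.2)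
  left_inv p := by simp
  right_inv p := by simp
  continuous_toFun := by
    have h : Continuous fun y => ((A y).toContinuousLinearEquiv : W →L[ℂ] W) :=
      continuous_clm_apply.2 hA
    exact continuous_fst.prodMk ((h.comp continuous_fst).clm_apply continuous_snd)
  continuous_invFun := by
    have : CompleteSpace W := FiniteDimensional.complete ℂ W
    have h : Continuous fun y => ((A y).toContinuousLinearEquiv : W →L[ℂ] W) :=
      continuous_clm_apply.2 hA
    -- inversion is continuous on the units of the Banach algebra `W →L[ℂ] W`
    have h' : Continuous fun y => ((A y).toContinuousLinearEquiv.symm : W →L[ℂ] W) := by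
      refine continuous_iff_continuousAt.2 fun y => ?_
      let U : Y → (W →L[ℂ] W)ˣ := fun y =>
        (ContinuousLinearEquiv.unitsEquiv ℂ W).symm (A y).toContinuousLinearEquiv
      have h1 : ContinuousAt (fun y => Ring.inverse (U y : W →L[ℂ] W)) y :=
        (NormedRing.inverse_continuousAt (U y)).comp (f := fun y => (U y : W →L[ℂ] W))
          h.continuousAt
      refine h1.congr (Filter.Eventually.of_forall fun z => ?_)
      exact Ring.inverse_unit (U z)
    exact continuous_fst.prodMk ((h'.comp continuous_fst).clm_apply continuous_snd)

variable {G : Type w} [Group G] {H : Subgroup G} {M : Type w} [TopologicalSpace M]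
    [MulAction G M] {F : Type w} {V : Type w} [NormedAddCommGroup F] [InnerProductSpace ℂ F]
    [NormedAddCommGroup V] [InnerProductSpace ℂ V] {ρ : Representation ℂ H V}

/-- `id ⊗ ρ(h)` as an automorphism of `F ⊗ V`. -/
noncomputable def tensorTwist (F : Type w) [NormedAddCommGroup F] [InnerProductSpace ℂ F]
    (ρ : Representation ℂ H V) (h : H) : (F ⊗[ℂ] V) ≃ₗ[ℂ] (F ⊗[ℂ] V) :=
  LinearEquiv.ofLinearMap (LinearMap.lTensor F (ρ h)) (LinearMap.lTensor F (ρ h⁻¹))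
    (by rw [← LinearMap.lTensor_comp, ← Module.End.mul_eq_comp, ← map_mul, mul_inv_cancel,
      map_one, Module.End.one_eq_id, LinearMap.lTensor_id])
    (by rw [← LinearMap.lTensor_comp, ← Module.End.mul_eq_comp, ← map_mul, inv_mul_cancel,
      map_one, Module.End.one_eq_id, LinearMap.lTensor_id])

lemma tensorTwist_apply (h : H) (t : F ⊗[ℂ] V) :
    tensorTwist F ρ h t = LinearMap.lTensor F (ρ h) t := rfl

lemma tensorTwist_mul (h h' : H) (t : F ⊗[ℂ] V) :
    tensorTwist F ρ (h * h') t = tensorTwist F ρ h (tensorTwist F ρ h' t) := by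
  simp only [tensorTwist_apply]
  rw [map_mul, Module.End.mul_eq_comp, LinearMap.lTensor_comp, LinearMap.comp_apply]

/-- A trivialization of `ξ` over `U` as an `H`-bundle, with fibre `F ⊗ V` and `H` acting through
`ρ`. -/
structure IsTensorTrivialization (ξ : VectG M F ρ) (U : Set M) (T : U × (F ⊗[ℂ] V) → ξ.Tot) :
    Prop where
  isOpenEmbedding : Topology.IsOpenEmbedding T
  linear : ∀ y : U, ∃ L : (F ⊗[ℂ] V) ≃ₗ[ℂ] ξ.bundle.E (y : M), ∀ t, T (y, t) = ⟨y, L t⟩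
  equivariant : ∀ (h : H) (y : U) (t : F ⊗[ℂ] V),
    ξ.gact h (T (y, t)) = T (y, tensorTwist F ρ h t)

/-- The tensor product structure of `ξ` as an `H`-bundle and a local trivialization of its factor
`ξ₀` with trivial `H`-action give local `H`-trivializations of `ξ`. The isomorphism `ξ₀ ⊗ V → ξ`
is only known to be continuous on the elements `e ⊗ v`; in finite dimensions this gives a continuous
family of matrices. -/
lemma exists_isTensorTrivialization [FiniteDimensional ℂ F] [FiniteDimensional ℂ V]
    (ξ : VectG M F ρ) {N : Set M} (hN : IsOpen N) {x : M} (hx : x ∈ N) :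
    ∃ U ⊆ N, IsOpen U ∧ x ∈ U ∧ ∃ T, IsTensorTrivialization ξ U T := by
  obtain ⟨ξ₀, τ, hτ, hτH⟩ := ξ.isTensor
  set e₀ := trivializationAt F ξ₀.E x
  set e := trivializationAt (F ⊗[ℂ] V) ξ.bundle.E x
  set U : Set M := N ∩ (e₀.baseSet ∩ e.baseSet)
  have hU : IsOpen U := hN.inter (e₀.open_baseSet.inter e.open_baseSet)
  have h0 : ∀ y : U, (y : M) ∈ e₀.baseSet := fun y => y.2.2.1
  have h1 : ∀ y : U, (y : M) ∈ e.baseSet := fun y => y.2.2.2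
  -- the isomorphism `τ` in the coordinates of `ξ₀` and of `ξ`
  let B : ∀ y : U, (F ⊗[ℂ] V) ≃ₗ[ℂ] ξ.bundle.E y := fun y =>
    (TensorProduct.congr (e₀.linearEquivAt ℂ y (h0 y)).symm (LinearEquiv.refl ℂ V)).trans (τ y)
  let A : U → (F ⊗[ℂ] V) ≃ₗ[ℂ] (F ⊗[ℂ] V) := fun y => (B y).trans (e.linearEquivAt ℂ y (h1 y))
  have hA : ∀ t, Continuous fun y => A y t := by
    intro t
    induction t using TensorProduct.induction_on with
    | zero => simpa using continuous_const
    | add s t hs ht =>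
      simp only [map_add]
      exact hs.add ht
    | tmul f v =>
      have hc : Continuous fun y : U => (⟨y, e₀.symm y f⟩ : ξ₀.Tot) := by
        have := (e₀.continuousOn_symm).comp_continuous
          (f := fun y : U => ((y : M), f)) (by fun_prop) (fun y => ⟨h0 y, trivial⟩)
        exact this
      have hc2 := (hτ v).comp hc
      have hc3 := e.continuousOn.comp_continuous hc2 (fun y => e.mem_source.2 (h1 y))
      exact continuous_snd.comp hc3
  let T : U × (F ⊗[ℂ] V) → ξ.Tot := fun p =>
    ((e.preimageHomeomorph (s := U) (fun y hy => hy.2.2)).symm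
      (homeomorphOfLinearFamily A hA p) : ξ.Tot)
  have hT : ∀ y t, T (y, t) = ⟨y, B y t⟩ := by
    intro y t
    change e.toOpenPartialHomeomorph.symm ((y : M), A y t) = _
    rw [← e.mk_symm (h1 y)]
    congr 1
    exact (e.linearEquivAt ℂ y (h1 y)).symm_apply_apply (B y t)
  refine ⟨U, Set.inter_subset_left, hU, ⟨hx, FiberBundle.mem_baseSet_trivializationAt' x,
    FiberBundle.mem_baseSet_trivializationAt' x⟩, T, ?_, fun y => ⟨B y, hT y⟩, fun h y t => ?_⟩
  · have ho : IsOpen ((Bundle.TotalSpace.proj : ξ.Tot → M) ⁻¹' U) :=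
      hU.preimage (FiberBundle.continuous_proj (F ⊗[ℂ] V) ξ.bundle.E)
    exact ho.isOpenEmbedding_subtypeVal.comp
      ((Homeomorph.isOpenEmbedding _).comp (Homeomorph.isOpenEmbedding _))
  · rw [hT, hT]
    refine (hτH h y _).trans ?_
    refine congrArg (fun v => (⟨y, v⟩ : ξ.Tot)) ?_
    -- `id ⊗ ρ(h)` commutes with the trivialization of `ξ₀` on the first factor
    have : (LinearMap.lTensor (ξ₀.E y) (ρ h)) ∘ₗ ((TensorProduct.congr
        (e₀.linearEquivAt ℂ y (h0 y)).symm (LinearEquiv.refl ℂ V)) : _ →ₗ[ℂ] _) =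
        ((TensorProduct.congr (e₀.linearEquivAt ℂ y (h0 y)).symm (LinearEquiv.refl ℂ V)) :
          _ →ₗ[ℂ] _) ∘ₗ LinearMap.lTensor F (ρ h) := by
      ext; rfl
    exact congrArg (τ y) (LinearMap.congr_fun this t)

/-- Translation by `g` on the total space of `ξ`. -/
def VectG.gactHomeomorph (ξ : VectG M F ρ) (g : G) : ξ.Tot ≃ₜ ξ.Tot where
  toFun := ξ.gact g
  invFun := ξ.gact g⁻¹
  left_inv e := by rw [← ξ.gact_mul, inv_mul_cancel, ξ.gact_one]
  right_inv e := by rw [← ξ.gact_mul, mul_inv_cancel, ξ.gact_one]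
  continuous_toFun := ξ.continuous_act g
  continuous_invFun := ξ.continuous_act g⁻¹

/-- Translation by `g` as a linear isomorphism of fibres. -/
noncomputable def VectG.actEquiv (ξ : VectG M F ρ) (g : G) (x : M) :
    ξ.bundle.E x ≃ₗ[ℂ] ξ.bundle.E (g • x) :=
  LinearEquiv.ofBijective (ξ.act g x) (by
    constructor
    · intro e e' h
      have h1 : (⟨x, e⟩ : ξ.Tot) = ⟨x, e'⟩ := ξ.gact_injective g (by simp only [VectG.gact, h])
      simpa using h1
    · intro v
      obtain ⟨⟨z, v'⟩, hz⟩ := (ξ.gactHomeomorph g).surjective ⟨g • x, v⟩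
      have hz' : (⟨g • z, ξ.act g z v'⟩ : ξ.Tot) = ⟨g • x, v⟩ := hz
      obtain rfl : z = x := MulAction.injective g (congrArg Bundle.TotalSpace.proj hz')
      exact ⟨v', by simpa using hz'⟩)

namespace IsTensorTrivialization

variable {ξ : VectG M F ρ} {U : Set M} {T : U × (F ⊗[ℂ] V) → ξ.Tot}

/-- The equivariant extension of `T` from the sheet of the unit class to the whole canonical
model. -/
noncomputable def extend (u : RightHMap H) (hT : IsTensorTrivialization ξ U T)
    (p : U × CanonicalModel H F V) : ξ.Tot :=
  Quotient.liftOn' p.2.1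
    (fun g : G => ξ.gact g (T (p.1, tensorTwist F ρ (u.toFun g)⁻¹ p.2.2))) (by
      intro a b hab
      rw [QuotientGroup.leftRel_apply] at hab
      obtain ⟨h, rfl⟩ : ∃ h : H, b = a * h := ⟨⟨_, hab⟩, by simp⟩
      rw [ξ.gact_mul, hT.equivariant, u.map_mul, ← tensorTwist_mul, mul_inv_rev,
        mul_inv_cancel_left])

variable {u : RightHMap H} (hT : IsTensorTrivialization ξ U T)

lemma extend_coe (y : U) (g : G) (t : F ⊗[ℂ] V) :
    hT.extend u (y, ((g : G ⧸ H), t)) =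
      ξ.gact g (T (y, tensorTwist F ρ (u.toFun g)⁻¹ t)) := rfl

lemma extend_eq (y : U) (g : G) : ∃ L : (F ⊗[ℂ] V) ≃ₗ[ℂ] ξ.bundle.E (g • (y : M)),
    ∀ t, hT.extend u (y, ((g : G ⧸ H), t)) = ⟨g • (y : M), L t⟩ := by
  obtain ⟨L, hL⟩ := hT.linear y
  exact ⟨(tensorTwist F ρ (u.toFun g)⁻¹).trans (L.trans (ξ.actEquiv g y)), fun t => by
    rw [extend_coe, hL]; rfl⟩

lemma extend_fst (y : U) (g : G) (t : F ⊗[ℂ] V) :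
    (hT.extend u (y, ((g : G ⧸ H), t))).1 = g • (y : M) := by
  obtain ⟨L, hL⟩ := hT.extend_eq (u := u) y g
  rw [hL]

lemma extend_equivariant (g : G) (y : U) (p : CanonicalModel H F V) :
    hT.extend u (y, canonicalAct ρ u g p) = ξ.gact g (hT.extend u (y, p)) := by
  obtain ⟨q, t⟩ := p
  induction q using QuotientGroup.induction_on with
  | H a =>
    change hT.extend u (y, (((g * a : G) : G ⧸ H),
      tensorTwist F ρ (u.toFun (g * a) * (u.toFun a)⁻¹) t)) = _
    rw [extend_coe, extend_coe, ξ.gact_mul, ← tensorTwist_mul, inv_mul_cancel_left]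

lemma extend_injective (hU : ∀ y ∈ U, ∀ g : G, g • y ∈ U → g ∈ H) :
    Function.Injective (hT.extend u) := by
  rintro ⟨y, q, t⟩ ⟨y', q', t'⟩ h
  induction q using QuotientGroup.induction_on with
  | H g =>
    induction q' using QuotientGroup.induction_on with
    | H g' =>
      have h1 := congrArg Bundle.TotalSpace.proj h
      change (hT.extend u _).1 = (hT.extend u _).1 at h1
      rw [extend_fst, extend_fst] at h1
      have hq : (g : G ⧸ H) = g' := by
        refine QuotientGroup.eq.2 (hU y' y'.2 _ ?_)
        rw [mul_smul, ← h1, inv_smul_smul]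
        exact y.2
      rw [← hq, extend_coe, extend_coe] at h
      have h2 := hT.isOpenEmbedding.injective (ξ.gact_injective g h)
      rw [Prod.mk.injEq] at h2
      rw [← hq, h2.1, (tensorTwist F ρ _).injective h2.2]

variable [TopologicalSpace G] [DiscreteTopology G] [FiniteDimensional ℂ F]
  [FiniteDimensional ℂ V]

/-- On each sheet the extension is an open embedding, and the sheets are open. -/
lemma map_extend_nhds (p : U × CanonicalModel H F V) :
    (𝓝 p).map (hT.extend u) = 𝓝 (hT.extend u p) := by
  obtain ⟨y, q, t⟩ := p
  induction q using QuotientGroup.induction_on with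
  | H g =>
    have ho : Topology.IsOpenEmbedding fun s : U × (F ⊗[ℂ] V) =>
        hT.extend u (s.1, ((g : G ⧸ H), s.2)) :=
      (ξ.gactHomeomorph g).isOpenEmbedding.comp (hT.isOpenEmbedding.comp
        ((Homeomorph.refl U).prodCongr
          (tensorTwist F ρ (u.toFun g)⁻¹).toContinuousLinearEquiv.toHomeomorph).isOpenEmbedding)
    rw [← ho.map_nhds_eq (y, t), nhds_prod_eq, nhds_discrete_prod, Filter.prod_map_right,
      Filter.map_map, ← nhds_prod_eq]
    rfl

end IsTensorTrivialization

variable [TopologicalSpace G] [DiscreteTopology G] [FiniteDimensional ℂ F]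
  [FiniteDimensional ℂ V]

/-- The equivariant chart which extends a trivialization of `ξ` as an `H`-bundle. -/
noncomputable def IsTensorTrivialization.chart (u : RightHMap H) {ξ : VectG M F ρ} {U : Set M}
    {T : U × (F ⊗[ℂ] V) → ξ.Tot} (hT : IsTensorTrivialization ξ U T) (hUo : IsOpen U)
    (hU : ∀ y ∈ U, ∀ g : G, g • y ∈ U → g ∈ H) : EquivariantChart u ξ where
  U := ⟨U, hUo⟩
  translates := hU
  ψ := by
    refine (Equiv.ofBijective (fun p : U × CanonicalModel H F V =>
      (⟨hT.extend u p, ?_⟩ : {e : ξ.Tot // ∃ y ∈ U, ∃ g : G, e.1 = g • y})) ⟨?_, ?_⟩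
      ).toHomeomorphOfContinuousOpen ?_ ?_
    · obtain ⟨y, q, t⟩ := p
      induction q using QuotientGroup.induction_on with
      | H g => exact ⟨y, y.2, g, hT.extend_fst y g t⟩
    · exact fun p p' h => hT.extend_injective hU (congrArg Subtype.val h)
    · rintro ⟨⟨x, v⟩, y, hy, g, hx⟩
      change x = g • y at hx
      subst hx
      obtain ⟨L, hL⟩ := hT.extend_eq (u := u) ⟨y, hy⟩ g
      exact ⟨(⟨y, hy⟩, ((g : G ⧸ H), L.symm v)), Subtype.ext
        ((hL _).trans (by rw [LinearEquiv.apply_symm_apply]))⟩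
    · exact Continuous.subtype_mk
        (continuous_iff_continuousAt.2 fun p => (hT.map_extend_nhds p).le) _
    · have h : IsOpenMap (hT.extend u) :=
        IsOpenMap.of_nhds_le fun p => (hT.map_extend_nhds p).ge
      exact h.subtype_mk _
  linear := fun y g => hT.extend_eq y g
  equivariant := fun g y p => hT.extend_equivariant g y p

theorem nonempty_equivariantAtlas [T2Space M] [LocallyCompactSpace M] [ProperSMul G M]
    (quasiFree : ∀ x : M, MulAction.stabilizer G x = H) (u : RightHMap H) (ξ : VectG M F ρ) :
    Nonempty (EquivariantAtlas u ξ) := by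
  have key : ∀ x : M, ∃ c : EquivariantChart u ξ, x ∈ c.U := by
    intro x
    obtain ⟨N, hN, hxN, htr⟩ := exists_isOpen_translates (quasiFree x)
    obtain ⟨U, hUN, hU, hxU, T, hT⟩ := exists_isTensorTrivialization ξ hN hxN
    exact ⟨hT.chart u hU fun y hy g hg => htr y (hUN hy) g (hUN hg), hxU⟩
  choose c hc using key
  exact ⟨⟨M, c, fun x => ⟨x, 1, by rw [one_smul]; exact hc x⟩⟩⟩

end LocalStructure

/-! ### The frame bundle and isomorphisms -/

section FrameBundle

variable {G : Type w} [Group G] {H : Subgroup G}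
    {M : Type w} [TopologicalSpace M] [MulAction G M] {F V : Type w}
    [NormedAddCommGroup F] [InnerProductSpace ℂ F]
    [NormedAddCommGroup V] [InnerProductSpace ℂ V]
    {ρ : Representation ℂ H V} {u : RightHMap H} {ξ η : VectG M F ρ}

/-- The inverse isomorphism. -/
def VectG.Iso.symm (f : VectG.Iso ξ η) : VectG.Iso η ξ where
  toHomeo := f.toHomeo.symm
  linear y := by
    obtain ⟨⟨x, v⟩, hxv⟩ : ∃ e, f.toHomeo.symm ⟨y, 0⟩ = e := ⟨_, rfl⟩
    obtain ⟨y', hy, L, hL⟩ := f.linear x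
    have h0 : f.toHomeo ⟨x, v⟩ = ⟨y, 0⟩ := by rw [← hxv, Homeomorph.apply_symm_apply]
    rw [hL] at h0
    obtain rfl : y' = y := congrArg Bundle.TotalSpace.proj h0
    refine ⟨x, hy.symm, L.symm, fun e => ?_⟩
    rw [Homeomorph.symm_apply_eq, hL, LinearEquiv.apply_symm_apply]
  equivariant g e := by
    rw [Homeomorph.symm_apply_eq, f.equivariant, Homeomorph.apply_symm_apply]

lemma VectG.Iso.ext {f f' : VectG.Iso ξ η} (h : ∀ e, f.toHomeo e = f'.toHomeo e) : f = f' := by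
  cases f; cases f'
  congr
  exact Homeomorph.ext h

lemma VectG.Iso.orbitMk_apply (f : VectG.Iso ξ η) (e : ξ.Tot) :
    orbitMk G (f.toHomeo e).1 = orbitMk G e.1 := by
  obtain ⟨y, hy, L, hL⟩ := f.linear e.1
  change orbitMk G (f.toHomeo ⟨e.1, e.2⟩).1 = _
  rw [hL, hy]

variable [TopologicalSpace G]

lemma EquivariantAtlas.exists_mem_base (A : EquivariantAtlas u ξ) (x : OrbitSpace G M) :
    ∃ i, x ∈ A.base i := by
  induction x using Quotient.inductionOn with
  | h x =>
    obtain ⟨i, g, hg⟩ := A.cover x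
    exact ⟨i, g • x, hg, orbitMk_smul g x⟩

lemma EquivariantAtlas.exists_frame (A : EquivariantAtlas u ξ) (x : OrbitSpace G M) :
    ∃ φ : Frame u ξ, φ.proj = x := by
  obtain ⟨i, y, hy, rfl⟩ := A.exists_mem_base x
  exact ⟨(A.chart i).frame ⟨y, hy⟩, EquivariantChart.proj_frame _ _⟩

/-- An isomorphism `ξ → η` carries frames of `ξ` to frames of `η`. -/
noncomputable def Frame.map (f : VectG.Iso ξ η) (φ : Frame u ξ) : Frame u η where
  val := (f.toHomeo : C(ξ.Tot, η.Tot)).comp φ.1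
  property := by
    refine ⟨fun q => ?_, fun g p => ?_⟩
    · obtain ⟨x, A, hA⟩ := φ.2.1 q
      obtain ⟨y, -, L, hL⟩ := f.linear x
      exact ⟨y, A.trans L, fun t => by
        change f.toHomeo (φ.1 (q, t)) = _
        rw [hA, hL]; rfl⟩
    · change f.toHomeo (φ.1 _) = η.gact g (f.toHomeo (φ.1 p))
      rw [φ.2.2, f.equivariant]

lemma Frame.continuous_map (f : VectG.Iso ξ η) :
    Continuous (Frame.map f : Frame u ξ → Frame u η) :=
  Continuous.subtype_mk ((ContinuousMap.continuous_postcomp _).comp Frame.continuous_val) _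

variable [DiscreteTopology G] [FiniteDimensional ℂ F] [FiniteDimensional ℂ V]
    (quasiFree : ∀ x : M, MulAction.stabilizer G x = H)

include quasiFree in
/-- The transition functions of an atlas exist because the frames of two charts over one orbit
differ by an element of `Aut_G(G₀ × (F ⊗ V))`. -/
lemma EquivariantAtlas.exists_transition (A : EquivariantAtlas u ξ) :
    ∃ Ψ : A.ι → A.ι → OrbitSpace G M → AutG F ρ u,
      ∀ (i j : A.ι) (y : (A.chart i).U) (z : (A.chart j).U),
        orbitMk G (y : M) = orbitMk G (z : M) → ∀ p : CanonicalModel H F V,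
          ((A.chart i).ψ (y, p) : ξ.Tot) =
            (A.chart j).ψ (z, (Ψ i j (orbitMk G (y : M))).1 p) := by
  have key : ∀ (i j : A.ι) (x : OrbitSpace G M), ∃ l : AutG F ρ u,
      ∀ (y : (A.chart i).U) (z : (A.chart j).U), orbitMk G (y : M) = x →
        orbitMk G (z : M) = x →
          (A.chart i).frame y = MulOpposite.op l • (A.chart j).frame z := by
    intro i j x
    by_cases h : ∃ (y : (A.chart i).U) (z : (A.chart j).U), orbitMk G (y : M) = x ∧
        orbitMk G (z : M) = x
    · obtain ⟨y, z, hy, hz⟩ := h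
      obtain ⟨l, hl⟩ := Frame.exists_smul_eq quasiFree (φ := (A.chart i).frame y)
        (φ' := (A.chart j).frame z) (by
          rw [EquivariantChart.proj_frame, EquivariantChart.proj_frame, hy, hz])
      refine ⟨l, fun y' z' hy' hz' => ?_⟩
      obtain rfl : y' = y := Subtype.ext
        ((A.chart i).orbitMk_injOn quasiFree y'.2 y.2 (hy'.trans hy.symm))
      obtain rfl : z' = z := Subtype.ext
        ((A.chart j).orbitMk_injOn quasiFree z'.2 z.2 (hz'.trans hz.symm))
      exact hl.symm
    · -- outside the overlap the value is arbitrary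
      exact ⟨1, fun y z hy hz => (h ⟨y, z, hy, hz⟩).elim⟩
  choose Ψ hΨ using key
  refine ⟨Ψ, fun i j y z hyz p => ?_⟩
  have := hΨ i j _ y z rfl hyz.symm
  rw [← EquivariantChart.frame_apply, this]
  rfl

variable [T2Space M] [LocallyCompactSpace M] [ProperSMul G M]

/-- The frame bundle of `ξ`, a principal bundle over `M / G₀` for the group
`Aut_G(G₀ × (F ⊗ V))`. -/
noncomputable def frameBundle (u : RightHMap H) (ξ : VectG M F ρ) :
    PrincipalBundle (AutG F ρ u) (OrbitSpace G M) where
  P := Frame u ξ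
  proj := Frame.proj
  continuous_proj := Frame.continuous_proj
  locallyTrivial x := by
    obtain ⟨A⟩ := nonempty_equivariantAtlas quasiFree u ξ
    obtain ⟨i, hi⟩ := A.exists_mem_base x
    refine ⟨_, (A.chart i).isOpen_base, hi, (A.chart i).frameTriv quasiFree,
      fun y l => ?_, fun y l l' => ?_⟩
    · rw [EquivariantChart.coe_frameTriv, Frame.proj_smul, EquivariantChart.proj_frame,
        EquivariantChart.orbitMk_homeoBase_symm]
    · rw [EquivariantChart.coe_frameTriv, EquivariantChart.coe_frameTriv, MulOpposite.op_mul,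
        mul_smul]

/-- An atlas of `ξ` trivializes the frame bundle with the transition functions of the atlas. -/
noncomputable def frameLocalTrivializations (A : EquivariantAtlas u ξ)
    {Ψ : A.ι → A.ι → OrbitSpace G M → AutG F ρ u}
    (hΨ : ∀ (i j : A.ι) (y : (A.chart i).U) (z : (A.chart j).U),
      orbitMk G (y : M) = orbitMk G (z : M) → ∀ p : CanonicalModel H F V,
        ((A.chart i).ψ (y, p) : ξ.Tot) =
          (A.chart j).ψ (z, (Ψ i j (orbitMk G (y : M))).1 p)) :
    (frameBundle quasiFree u ξ).LocalTrivializations A.base Ψ where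
  triv i := (A.chart i).frameTriv quasiFree
  proj_triv i x l := (Frame.proj_smul l _).trans
    ((EquivariantChart.proj_frame _ _).trans
      (EquivariantChart.orbitMk_homeoBase_symm _ quasiFree x))
  equivariant i x l l' := mul_smul (MulOpposite.op l') (MulOpposite.op l)
    ((A.chart i).frame (((A.chart i).homeoBase quasiFree).symm x))
  transition i j x hi hj l := by
    refine Frame.ext fun p => ?_
    have h1 := (A.chart i).orbitMk_homeoBase_symm quasiFree ⟨x, hi⟩
    have h2 := (A.chart j).orbitMk_homeoBase_symm quasiFree ⟨x, hj⟩
    have h3 := hΨ i j _ _ (h1.trans h2.symm) (l.1 p)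
    rw [h1] at h3
    exact h3

variable {P Q : PrincipalBundle (AutG F ρ u) (OrbitSpace G M)}

namespace TransitionCharts

/-- Trivializations of `P` with the transition functions of an atlas of `ξ` identify `P` with the
frame bundle of `ξ`: the frame `ψ_i(y, l ·)` corresponds to the point of `P` with coordinate `l`. -/
lemma exists_iso {A : EquivariantAtlas u ξ} (S : TransitionCharts A P) :
    ∃ κ : PrincipalBundle.Iso (frameBundle quasiFree u ξ) P,
      ∀ (i : A.ι) (y : (A.chart i).U) (l : AutG F ρ u),
        κ.toHomeo (MulOpposite.op l • (A.chart i).frame y : Frame u ξ) =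
          S.τ i (⟨orbitMk G (y : M), Set.mem_image_of_mem _ y.2⟩, l) := by
  let T : P.LocalTrivializations A.base S.Ψ :=
    ⟨S.τ, S.proj_τ, S.equivariant, S.principal_transition⟩
  obtain ⟨κ, hκ⟩ := (frameLocalTrivializations quasiFree A S.vector_transition).exists_iso T
    (fun i => (A.chart i).isOpen_base) A.exists_mem_base
  refine ⟨κ, fun i y l => ?_⟩
  have hy := (A.chart i).homeoBase_symm quasiFree y (Set.mem_image_of_mem _ y.2)
  exact (congrArg (fun z : (A.chart i).U =>
    κ.toHomeo (MulOpposite.op l • (A.chart i).frame z : Frame u ξ)) hy.symm).trans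
      (hκ i ⟨orbitMk G (y : M), Set.mem_image_of_mem _ y.2⟩ l)

/-- Conversely, trivializations of the frame bundle are transported to any isomorphic bundle. -/
lemma nonempty_of_iso (A : EquivariantAtlas u ξ)
    (κ : PrincipalBundle.Iso (frameBundle quasiFree u ξ) P) : Nonempty (TransitionCharts A P) := by
  obtain ⟨Ψ, hΨ⟩ := A.exists_transition quasiFree
  let C := frameLocalTrivializations quasiFree A hΨ
  exact ⟨{
    Ψ := Ψ
    vector_transition := hΨ
    τ := fun i => (C.triv i).trans (κ.toHomeo.subtype fun p => by rw [κ.proj_eq])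
    proj_τ := fun i x l => (κ.proj_eq _).trans (C.proj_triv i x l)
    equivariant := fun i x l l' =>
      (congrArg κ.toHomeo (C.equivariant i x l l')).trans (κ.equivariant _ _)
    principal_transition := fun i j x hi hj l =>
      congrArg κ.toHomeo (C.transition i j x hi hj l) }⟩

end TransitionCharts

/-- The isomorphism of frame bundles induced by an isomorphism `ξ → η`. -/
noncomputable def frameBundleMap (u : RightHMap H) (f : VectG.Iso ξ η) :
    PrincipalBundle.Iso (frameBundle quasiFree u ξ) (frameBundle quasiFree u η) where
  toHomeo :=
    { toFun := Frame.map f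
      invFun := Frame.map f.symm
      left_inv := fun φ => Frame.ext fun p => f.toHomeo.symm_apply_apply (φ.1 p)
      right_inv := fun φ => Frame.ext fun p => f.toHomeo.apply_symm_apply (φ.1 p)
      continuous_toFun := Frame.continuous_map f
      continuous_invFun := Frame.continuous_map f.symm }
  proj_eq _ := f.orbitMk_apply _
  equivariant _ _ := rfl

/-- An isomorphism of frame bundles as a map between the spaces of frames. -/
noncomputable def frameFun (k : PrincipalBundle.Iso (frameBundle quasiFree u ξ)
    (frameBundle quasiFree u η)) : Frame u ξ → Frame u η := k.toHomeo

/-- An isomorphism `k` of frame bundles comes from a continuous map of total spaces: send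
`φ p` to `(k φ) p`. -/
lemma exists_total_map (k : PrincipalBundle.Iso (frameBundle quasiFree u ξ)
    (frameBundle quasiFree u η)) :
    ∃ f : ξ.Tot → η.Tot, Continuous f ∧ ∀ (φ : Frame u ξ) (p : CanonicalModel H F V),
      f (φ.1 p) = (frameFun quasiFree k φ).1 p := by
  obtain ⟨A⟩ := nonempty_equivariantAtlas quasiFree u ξ
  let K := frameFun quasiFree k
  have hK : Continuous K := k.toHomeo.continuous
  have hKl : ∀ (l : AutG F ρ u) (φ : Frame u ξ),
    K (MulOpposite.op l • φ) = MulOpposite.op l • K φ := k.equivariant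
  choose Φ hΦ using fun e : ξ.Tot => A.exists_frame (orbitMk G e.1)
  choose p hp using fun e : ξ.Tot => (Φ e).exists_apply_eq (hΦ e).symm
  -- the value at a point does not depend on the frame through it, as `k` commutes with `L`
  have key : ∀ (φ : Frame u ξ) (q : CanonicalModel H F V),
      (K (Φ (φ.1 q))).1 (p (φ.1 q)) = (K φ).1 q := by
    intro φ q
    obtain ⟨l, hl⟩ := Frame.exists_smul_eq quasiFree (φ := φ) (φ' := Φ (φ.1 q))
      ((φ.orbitMk_apply q).symm.trans (hΦ _).symm)
    have h1 : p (φ.1 q) = l.1 q := (Φ (φ.1 q)).2.injective quasiFree (by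
      rw [hp, ← Frame.smul_apply, hl])
    rw [h1, ← Frame.smul_apply, ← hKl, hl]
  refine ⟨fun e => (K (Φ e)).1 (p e), ?_, key⟩
  refine continuous_iff_continuousAt.2 fun e => ?_
  obtain ⟨i, g, hg⟩ := A.cover e.1
  set c := A.chart i
  -- on the domain of a chart, the map is `ψ (y, q) ↦ (k (ψ (y, ·))) q`
  set O : Set ξ.Tot := {e : ξ.Tot | ∃ y ∈ c.U, ∃ g : G, e.1 = g • y} with hO
  have hOpen : IsOpen O := by
    have : O = (fun e : ξ.Tot => orbitMk G e.1) ⁻¹' c.base := by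
      ext e
      simp only [hO, Set.mem_ofPred_eq, Set.mem_preimage, EquivariantChart.base, Set.mem_image]
      refine exists_congr fun y => and_congr Iff.rfl ?_
      rw [eq_comm (a := orbitMk G y), orbitMk_eq_iff]
      exact exists_congr fun g => eq_comm
    rw [this]
    exact c.isOpen_base.preimage (continuous_quotient_mk'.comp
      (FiberBundle.continuous_proj (F ⊗[ℂ] V) ξ.bundle.E))
  have heO : e ∈ O := ⟨_, hg, g⁻¹, (inv_smul_smul g e.1).symm⟩
  refine ContinuousOn.continuousAt (s := O) ?_ (hOpen.mem_nhds heO)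
  rw [continuousOn_iff_continuous_domRestrict]
  have hc : Continuous fun x : c.U × CanonicalModel H F V => (K (c.frame x.1)).1 x.2 :=
    (Frame.continuous_val.comp (hK.comp (c.continuous_frame.comp continuous_fst))).eval
      continuous_snd
  refine (hc.comp c.ψ.symm.continuous).congr fun e' => ?_
  obtain ⟨⟨y, q⟩, rfl⟩ := c.ψ.surjective e'
  rw [Function.comp_apply, Homeomorph.symm_apply_apply]
  exact (key (c.frame y) q).symm

/-- Isomorphisms of equivariant bundles are the same as isomorphisms of their frame bundles. -/
lemma frameBundleMap_bijective :
    Function.Bijective (frameBundleMap quasiFree u : VectG.Iso ξ η → _) := by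
  obtain ⟨A⟩ := nonempty_equivariantAtlas quasiFree u ξ
  obtain ⟨B⟩ := nonempty_equivariantAtlas quasiFree u η
  have form : ∀ {ζ : VectG M F ρ} (_ : EquivariantAtlas u ζ) (e : ζ.Tot),
      ∃ (φ : Frame u ζ) (p : _), φ.1 p = e := fun C e => by
    obtain ⟨φ, hφ⟩ := C.exists_frame (orbitMk G e.1)
    exact ⟨φ, φ.exists_apply_eq hφ.symm⟩
  constructor
  · intro f f' h
    refine VectG.Iso.ext fun e => ?_
    obtain ⟨φ, p, rfl⟩ := form A e
    exact congrArg (fun k : PrincipalBundle.Iso (frameBundle quasiFree u ξ)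
      (frameBundle quasiFree u η) => (frameFun quasiFree k φ).1 p) h
  · intro k
    obtain ⟨f, hfc, hf⟩ := exists_total_map quasiFree k
    obtain ⟨f', hfc', hf'⟩ := exists_total_map quasiFree k.symm
    let F₁ : VectG.Iso ξ η :=
      { toHomeo :=
          { toFun := f
            invFun := f'
            left_inv := fun e => by
              obtain ⟨φ, p, rfl⟩ := form A e
              rw [hf, hf']
              exact congrArg (fun φ : Frame u ξ => φ.1 p) (k.toHomeo.symm_apply_apply φ)
            right_inv := fun e => by
              obtain ⟨φ, p, rfl⟩ := form B e
              rw [hf', hf]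
              exact congrArg (fun φ : Frame u η => φ.1 p) (k.toHomeo.apply_symm_apply φ)
            continuous_toFun := hfc
            continuous_invFun := hfc' }
        linear := fun x => by
          obtain ⟨φ, ⟨q, t₀⟩, h0⟩ := form A ⟨x, 0⟩
          obtain ⟨x', L, hL⟩ := φ.2.1 q
          obtain rfl : x' = x := by
            rw [hL] at h0
            exact congrArg Bundle.TotalSpace.proj h0
          let φ' := frameFun quasiFree k φ
          obtain ⟨y, L', hL'⟩ := φ'.2.1 q
          refine ⟨y, ?_, L.symm.trans L', fun e => ?_⟩
          · have h1 := φ'.orbitMk_apply (q, 0)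
            have h2 := φ.orbitMk_apply (q, 0)
            rw [hL'] at h1
            rw [hL] at h2
            exact h1.trans ((k.proj_eq φ).trans h2.symm)
          · have h1 := hf φ (q, L.symm e)
            rw [hL, LinearEquiv.apply_symm_apply] at h1
            exact h1.trans (hL' _)
        equivariant := fun g e => by
          obtain ⟨φ, p, rfl⟩ := form A e
          change f _ = η.gact g (f _)
          rw [← φ.2.2, hf, hf]
          exact (frameFun quasiFree k φ).2.2 g p }
    exact ⟨F₁, PrincipalBundle.Iso.ext fun φ => Frame.ext (hf φ)⟩

/-- In terms of the identifications `κ` of `P` and `Q` with the frame bundles, `f` and `k`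
correspond to each other if `k` is the map of frame bundles induced by `f`. -/
lemma corresponds_iff {A : EquivariantAtlas u ξ} {B : EquivariantAtlas u η}
    (S : TransitionCharts A P) (T : TransitionCharts B Q)
    {κ : PrincipalBundle.Iso (frameBundle quasiFree u ξ) P}
    (hκ : ∀ (i : A.ι) (y : (A.chart i).U) (l : AutG F ρ u),
        κ.toHomeo (MulOpposite.op l • (A.chart i).frame y : Frame u ξ) =
          S.τ i (⟨orbitMk G (y : M), Set.mem_image_of_mem _ y.2⟩, l))
    {μ : PrincipalBundle.Iso (frameBundle quasiFree u η) Q}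
    (hμ : ∀ (i : B.ι) (y : (B.chart i).U) (l : AutG F ρ u),
        μ.toHomeo (MulOpposite.op l • (B.chart i).frame y : Frame u η) =
          T.τ i (⟨orbitMk G (y : M), Set.mem_image_of_mem _ y.2⟩, l))
    (f : VectG.Iso ξ η) (k : PrincipalBundle.Iso P Q) :
    Corresponds S T f k ↔ (κ.trans k).trans μ.symm = frameBundleMap quasiFree u f := by
  have local_form : ∀ {ζ : VectG M F ρ} (C : EquivariantAtlas u ζ) (φ : Frame u ζ),
      ∃ (i : C.ι) (y : (C.chart i).U) (l : AutG F ρ u), orbitMk G (y : M) = φ.proj ∧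
        φ = MulOpposite.op l • (C.chart i).frame y := fun C φ => by
    obtain ⟨i, y, hy, hyφ⟩ := C.exists_mem_base φ.proj
    obtain ⟨l, hl⟩ := Frame.exists_smul_eq quasiFree (φ := φ)
      (φ' := (C.chart i).frame ⟨y, hy⟩) (by rw [EquivariantChart.proj_frame, hyφ])
    exact ⟨i, ⟨y, hy⟩, l, hyφ, hl.symm⟩
  have rhs_iff : ∀ (i : A.ι) (j : B.ι) (y : (A.chart i).U) (z : (B.chart j).U)
      (l l' : AutG F ρ u), (∀ p : CanonicalModel H F V,
        f.toHomeo ((A.chart i).ψ (y, l.1 p)) = ((B.chart j).ψ (z, l'.1 p) : η.Tot)) ↔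
      Frame.map f (MulOpposite.op l • (A.chart i).frame y) =
        MulOpposite.op l' • (B.chart j).frame z :=
    fun i j y z l l' => ⟨fun h => Frame.ext h, fun h p => congrArg (fun φ => φ.1 p) h⟩
  constructor
  · intro h
    refine PrincipalBundle.Iso.ext fun φ => ?_
    change μ.toHomeo.symm (k.toHomeo (κ.toHomeo φ)) = Frame.map f φ
    refine μ.toHomeo.symm_apply_eq.2 ?_
    obtain ⟨i, y, l, hy, rfl⟩ := local_form A φ
    obtain ⟨j, z, l', hz, hφ'⟩ := local_form B
      (Frame.map f (MulOpposite.op l • (A.chart i).frame y))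
    rw [hφ']
    refine (congrArg k.toHomeo (hκ i y l)).trans (((h i j y z ?_ l l').2
      ((rhs_iff i j y z l l').2 hφ')).trans (hμ j z l').symm)
    rw [hy, hz]
    exact (f.orbitMk_apply _).symm
  · intro h i j y z _ l l'
    have h1 : k.toHomeo (κ.toHomeo (MulOpposite.op l • (A.chart i).frame y : Frame u ξ)) =
        μ.toHomeo (Frame.map f (MulOpposite.op l • (A.chart i).frame y)) :=
      μ.toHomeo.symm_apply_eq.1 (congrArg (fun k : PrincipalBundle.Iso
        (frameBundle quasiFree u ξ) (frameBundle quasiFree u η) =>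
          k.toHomeo (MulOpposite.op l • (A.chart i).frame y : Frame u ξ)) h)
    rw [rhs_iff, ← hκ, ← hμ, h1]
    exact μ.toHomeo.injective.eq_iff

end FrameBundle

theorem mainTheorem4 {G : Type w} [Group G] [TopologicalSpace G] [DiscreteTopology G]
    (H : Subgroup G) [H.Normal] [Finite H]
    {M : Type w} [TopologicalSpace M] [T2Space M] [LocallyCompactSpace M]
    [MulAction G M] [ProperSMul G M]
    (quasiFree : ∀ x : M, MulAction.stabilizer G x = H)
    (F V : Type w) [NormedAddCommGroup F] [InnerProductSpace ℂ F] [FiniteDimensional ℂ F]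
    [NormedAddCommGroup V] [InnerProductSpace ℂ V] [FiniteDimensional ℂ V]
    (ρ : Representation ℂ H V) [ρ.IsIrreducible] (u : RightHMap H) :
    (∀ ξ : VectG M F ρ, Nonempty (EquivariantAtlas u ξ)) ∧
    (∃ Φ : Quotient (VectG.setoid (M := M) (F := F) (ρ := ρ)) →
        Quotient (PrincipalBundle.setoid (L := AutG F ρ u) (X := OrbitSpace G M)),
      (∀ (ξ : VectG M F ρ) (A : EquivariantAtlas u ξ)
        (P : PrincipalBundle (AutG F ρ u) (OrbitSpace G M)),
          Φ (Quotient.mk _ ξ) = Quotient.mk _ P ↔ Nonempty (TransitionCharts A P)) ∧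
      Function.Injective Φ) ∧
    (∀ (ξ η : VectG M F ρ) (A : EquivariantAtlas u ξ) (B : EquivariantAtlas u η)
      (P Q : PrincipalBundle (AutG F ρ u) (OrbitSpace G M))
      (S : TransitionCharts A P) (T : TransitionCharts B Q),
        (∀ f : VectG.Iso ξ η, ∃! k : PrincipalBundle.Iso P Q, Corresponds S T f k) ∧
        (∀ k : PrincipalBundle.Iso P Q, ∃! f : VectG.Iso ξ η, Corresponds S T f k)) := by
  refine ⟨nonempty_equivariantAtlas quasiFree u, ⟨Quotient.map (frameBundle quasiFree u)
    fun _ _ ⟨f⟩ => ⟨frameBundleMap quasiFree u f⟩, fun ξ A P => ?_, ?_⟩, ?_⟩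
  · rw [Quotient.map_mk, Quotient.eq]
    refine ⟨fun ⟨κ⟩ => TransitionCharts.nonempty_of_iso quasiFree A κ, fun ⟨S⟩ => ?_⟩
    obtain ⟨κ, -⟩ := S.exists_iso quasiFree
    exact ⟨κ⟩
  · intro a b h
    induction a, b using Quotient.inductionOn₂ with
    | h ξ η =>
      rw [Quotient.map_mk, Quotient.map_mk, Quotient.eq] at h
      obtain ⟨k⟩ := h
      obtain ⟨f, -⟩ := (frameBundleMap_bijective quasiFree).2 k
      exact Quotient.sound ⟨f⟩
  · intro ξ η A B P Q S T
    obtain ⟨κ, hκ⟩ := S.exists_iso quasiFree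
    obtain ⟨μ, hμ⟩ := T.exists_iso quasiFree
    simp only [corresponds_iff quasiFree S T hκ hμ]
    refine ⟨fun f => ?_, fun k => ?_⟩
    · refine ⟨(κ.symm.trans (frameBundleMap quasiFree u f)).trans μ, ?_, fun k hk => ?_⟩
      · refine PrincipalBundle.Iso.ext fun φ => ?_
        change μ.toHomeo.symm (μ.toHomeo _) = _
        rw [Homeomorph.symm_apply_apply]
        exact congrArg (frameBundleMap quasiFree u f).toHomeo (κ.toHomeo.symm_apply_apply φ)
      · rw [← hk]
        refine PrincipalBundle.Iso.ext fun p => ?_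
        change _ = μ.toHomeo (μ.toHomeo.symm (k.toHomeo (κ.toHomeo (κ.toHomeo.symm p))))
        rw [Homeomorph.apply_symm_apply, Homeomorph.apply_symm_apply]
    · obtain ⟨f, hf⟩ := (frameBundleMap_bijective quasiFree).2 ((κ.trans k).trans μ.symm)
      exact ⟨f, hf.symm, fun f' hf' =>
        (frameBundleMap_bijective quasiFree).1 (hf'.symm.trans hf.symm)⟩
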